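/- Let $W$ be a commutative ring and let $n>0$ be an integer which is invertible in $W$. Put $$X=\operatorname{Spec} W[[x,y,s]]/(sx-y^n),\qquad C=\{s=y=0\}\subset X,\qquad O=\{x=y=s=0\}\cong\operatorname{Spec}W ,$$ so that the principal divisor $\{s=0\}$ of $X$ is supported on $C$ (it is "$nC$"). Conventions. A $W$-scheme $Y$ with an ideal sheaf $J$ is *smooth over $W$ of relative dimension $d$* (as a smooth $W$-scheme or a completion of one along a closed subscheme) if $Y$ is the only open neighbourhood of $V(J)$ and each point of $V(J)$ has an affine open neighbourhood $U=\operatorname{Spec}B$ with *local coordinates* $x_1,\dots,x_d\in B$: with $I=J(U)$, the ring $B/I$ is of finite presentation over $W$, and $B$ is formally étale over $W[T_1,\dots,T_d]$, $T_i\mapsto x_i$, for the $I$-adic topology (for $J=0$ this is ordinary smoothness). A divisor is a *relative NCD over $W$* if near each point of $V(J)$ it is given by a non-zero-divisor $x_1\cdots x_r$, where $x_1,\dots,x_d$ are local coordinates and $0\le r\le d$; a sum of divisors is a *simple* relative NCD if moreover each of its components is smooth over $W$ of relative dimension $d-1$. For a scheme $X'$ over $X$ and its closed subschemes, $J$ is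 the ideal sheaf generated by $x,y,s$. Then there are a scheme $X'$, a proper morphism $\rho:X'\to X$ and closed subschemes $E_1,\dots,E_{n-1}$ of $X'$ such that, with $C'$ the proper transform of $C$ (the scheme-theoretic closure in $X'$ of $\rho^{-1}(C\setminus O)$): 1. $X'$ is smooth over $W$ of relative dimension $2$, and $\rho$ restricts to an isomorphism $X'\setminus\rho^{-1}(C)\cong X\setminus C$. 2. $E_1,\dots,E_{n-1}$ are exceptional curves, that is, $\rho$ contracts each of them to $O$ and they are smooth proper curves over $W$ with geometrically irreducible fibres. 3. The pull-back by $\rho$ of the divisor $\{s=0\}$ is the divisor $$D=E_1+2E_2+\cdots+(n-1)E_{n-1}+nC',$$ and the support of $D$ is $\rho^{-1}(C)$. 4. $E_1+E_2+\cdots+E_{n-1}+C'$ is a simple relative NCD over $W$. 5. These components form a chain: with $E_n:=C'$, the scheme-theoretic intersection $E_i\cap E_{i+1}$ maps isomorphically to $\operatorname{Spec}W$ for $1\le i<n$, and $E_i\cap E_j=\emptyset$ if $j>i+1$. -/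

import Mathlib

open AlgebraicGeometry CategoryTheory

universe u

noncomputable section

namespace AnSing

/-! ### Relative local coordinates, smoothness and normal crossing divisors over a ring

The schemes considered here need not be of finite type over the base ring `W`: they are smooth
`W`-schemes *or completions of such along a closed subscheme*.  A scheme `Y` over `W` is therefore
always taken together with an ideal sheaf `J`, which defines the adic topology (for an honest
`W`-scheme of finite presentation, `J = 0`). -/

/-- Let `φ : W → B` be a `W`-algebra and `I` an ideal of `B`.  The elements `x₁, …, x_d` of `B` are
*local coordinates over `W`* for the `I`-adic topology if `B ⧸ I` is of finite presentation over `W`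
and `B`, with its `I`-adic topology, is formally étale over `W[T₁, …, T_d]` by `T_i ↦ x_i`:
a `W`-homomorphism `f` from `B` to `C ⧸ N` with `N ^ 2 = 0` that is continuous (it kills a power of
`I`) lifts uniquely to a `W`-homomorphism `B → C` with prescribed values at the `x_i`.

For `I = 0` this says that `W[T₁, …, T_d] → B` is étale; in general it says that the completion of
`B` is, locally, the completion along a closed subscheme of a `W`-scheme which is
étale over the affine space with coordinates `x₁, …, x_d`. -/
def IsLocalCoordinates {W B : Type u} [CommRing W] [CommRing B] (φ : W →+* B) (I : Ideal B)
    {d : ℕ} (x : Fin d → B) : Prop :=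
  ((Ideal.Quotient.mk I).comp φ).FinitePresentation ∧
  ∀ (C : Type u) [CommRing C] (ψ : W →+* C) (N : Ideal C), N ^ 2 = ⊥ →
    ∀ (f : B →+* C ⧸ N), f.comp φ = (Ideal.Quotient.mk N).comp ψ →
      (∃ k : ℕ, I ^ k ≤ RingHom.ker f) →
      ∀ c : Fin d → C, (∀ i, f (x i) = Ideal.Quotient.mk N (c i)) →
        ∃! g : B →+* C, g.comp φ = ψ ∧ (∀ i, g (x i) = c i) ∧ (Ideal.Quotient.mk N).comp g = f

/-- The structure homomorphism `W → Γ(Y, U)` of a scheme `Y` over `Spec W`. -/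
def structureHom {W : Type u} [CommRing W] {Y : Scheme.{u}} (p : Y ⟶ Spec (.of W)) (U : Y.Opens) :
    W →+* Γ(Y, U) :=
  ((Scheme.ΓSpecIso (.of W)).inv ≫ p.appTop ≫ Y.presheaf.map (homOfLE le_top).op).hom

/-- `Y` (with the topology given by the ideal sheaf `J`) is smooth over `W` of relative dimension
`d`: every open neighbourhood of the closed subset `V(J)` is the whole of `Y`, and each point of
`V(J)` has an affine open neighbourhood with `d` local coordinates over `W`. -/
def IsSmoothOver {W : Type u} [CommRing W] {Y : Scheme.{u}} (p : Y ⟶ Spec (.of W))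
    (J : Y.IdealSheafData) (d : ℕ) : Prop :=
  (∀ V : Y.Opens, (J.support : Set Y) ⊆ V → V = ⊤) ∧
  ∀ z ∈ J.support, ∃ U : Y.affineOpens, z ∈ U.1 ∧
    ∃ x : Fin d → Γ(Y, U.1), IsLocalCoordinates (structureHom p U.1) (J.ideal U) x

/-- The closed subscheme with ideal sheaf `D` is a relative normal crossing divisor over `W`:
locally it is an effective Cartier divisor with equation `x₁ ⋯ x_s = 0`, where
`x₁, …, x_d` are local coordinates over `W`. -/
def IsRelativeNCD {W : Type u} [CommRing W] {Y : Scheme.{u}} (p : Y ⟶ Spec (.of W))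
    (J : Y.IdealSheafData) (d : ℕ) (D : Y.IdealSheafData) : Prop :=
  (∀ V : Y.Opens, (J.support : Set Y) ⊆ V → V = ⊤) ∧
  ∀ z ∈ J.support, ∃ U : Y.affineOpens, z ∈ U.1 ∧
    ∃ x : Fin d → Γ(Y, U.1), IsLocalCoordinates (structureHom p U.1) (J.ideal U) x ∧
      ∃ S : Finset (Fin d), ∏ i ∈ S, x i ∈ nonZeroDivisors Γ(Y, U.1) ∧
        D.ideal U = Ideal.span {∏ i ∈ S, x i}

/-- The divisor `∑ i ∈ S, E i` is a simple relative normal crossing divisor over `W` with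
components `E i`: it is a relative normal crossing divisor and each `E i` is smooth over `W`, of
relative dimension one less.  (The sum of divisors is the product of their ideal sheaves.) -/
def IsSimpleRelativeNCD {W : Type u} [CommRing W] {Y : Scheme.{u}} (p : Y ⟶ Spec (.of W))
    (J : Y.IdealSheafData) (d : ℕ) (S : Finset ℕ) (E : ℕ → Y.IdealSheafData) : Prop :=
  IsRelativeNCD p J d (∏ i ∈ S, E i) ∧
  ∀ i ∈ S, IsSmoothOver ((E i).subschemeι ≫ p) (J.comap (E i).subschemeι) (d - 1)

/-! ### The singularity `s x = y ^ n` -/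

variable (W : Type u) [CommRing W] (n : ℕ)

/-- The power series ring `W[[x, y, s]]`; the variables `x, y, s` have the indices `0, 1, 2`. -/
abbrev PS : Type u := MvPowerSeries (Fin 3) W

/-- The ring `W[[x, y, s]] / (s x - y ^ n)`. -/
abbrev R : Type u :=
  PS W ⧸ Ideal.span {(MvPowerSeries.X 2 * MvPowerSeries.X 0 - MvPowerSeries.X 1 ^ n : PS W)}

/-- The classes of `x`, `y`, `s` for `j = 0, 1, 2`. -/
def coord (j : Fin 3) : R W n := Ideal.Quotient.mk _ (MvPowerSeries.X j)

/-- `X = Spec W[[x, y, s]] / (s x - y ^ n)`. -/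
abbrev X : Scheme.{u} := Spec (.of (R W n))

/-- The structure morphism `X ⟶ Spec W`. -/
def toBase : X W n ⟶ Spec (.of W) := Spec.map (CommRingCat.ofHom (algebraMap W (R W n)))

/-- The closed subscheme of `X` defined by an ideal. -/
def closedSub (I : Ideal (R W n)) : (X W n).IdealSheafData :=
  Scheme.IdealSheafData.ofIdealTop (I.map (Scheme.ΓSpecIso (.of (R W n))).inv.hom)

/-- The closed subscheme `C = {s = y = 0}` of `X`. -/
def C : (X W n).IdealSheafData := closedSub W n (Ideal.span {coord W n 2, coord W n 1})

/-- The principal divisor `{s = 0}` of `X`, whose support is that of `C`. -/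
def divS : (X W n).IdealSheafData := closedSub W n (Ideal.span {coord W n 2})

/-- The origin `O = {x = y = s = 0}` of `X`, a copy of `Spec W`. -/
def origin : (X W n).IdealSheafData :=
  closedSub W n (Ideal.span {coord W n 0, coord W n 1, coord W n 2})

variable {W n}

/-- The proper transform of `C`: the scheme-theoretic closure in `X'` of the inverse image of
`C \ O`. -/
def properTransform {X' : Scheme.{u}} (ρ : X' ⟶ X W n) : X'.IdealSheafData :=
  Scheme.Hom.ker
    ((((C W n).comap ρ).subschemeι ⁻¹ᵁ (ρ ⁻¹ᵁ (origin W n).support.compl)).ι ≫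
      ((C W n).comap ρ).subschemeι)

/-- `E` is an exceptional curve of `ρ`: it is contracted to the origin `O = Spec W`, and it is a
smooth proper curve over `W` with geometrically irreducible fibres. -/
structure IsExceptionalCurve {X' : Scheme.{u}} (ρ : X' ⟶ X W n) (E : X'.IdealSheafData) :
    Prop where
  contracted : (origin W n).comap ρ ≤ E
  proper : IsProper (E.subschemeι ≫ ρ ≫ toBase W n)
  smooth : SmoothOfRelativeDimension 1 (E.subschemeι ≫ ρ ≫ toBase W n)
  geomIrred : GeometricallyIrreducible (E.subschemeι ≫ ρ ≫ toBase W n)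

end AnSing

end

/-!
The resolution `X'` is a single blowing up of `X`. Over `R[1/y]`, a ring which contains the ring `R`
of the singularity, consider for `0 ≤ k < n` the elements `u = y ^ (k + 1) / s` and `v = s / y ^ k`.
Then `y = u v`, `s = u ^ k v ^ (k + 1)` and `x = u ^ (n - k) v ^ (n - k - 1)`. In the toric picture,
the fan of the singularity is a cone which is subdivided into `n` regular cones, and `u`, `v` are the
coordinates of the `k`-th one. The subdivision is given by the ideal generated by
`f k = s ^ (n - 1 - k) y ^ (1 + ⋯ + k)` for `k < n` (`blowupGenerator`), since `f (k + 1) / f k` is the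
coordinate `u` of the `k`-th chart and its inverse is the coordinate `v` of the next one. Hence the
charts of the blowing up of this ideal have the coordinate rings `R[u, v] ⊆ R[1/y]`, and properness
comes from the construction as `Proj` of the Rees algebra (`exists_blowup`, `exists_areCharts`).

The chart rings `B = R[u, v]` are not of finite type over `W`, so everything about them is derived
from two properties (`IsChart`): `B` is generated by `u` and `v` over `R`, and there is a homomorphism
from `B` to `W[[u, v]]` that maps `u` and `v` to the variables. As every element of `R` is a constant
modulo the ideal of the origin `O`, the first property shows that `W[u, v] → B` is surjective modulo
the ideal of `O`. That ideal is generated by monomials in `u` and `v`, and a monomial ideal of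
`W[u, v]` is contracted from `W[[u, v]]`; so `W[u, v] → B` induces isomorphisms modulo all powers of
the ideal of `O`. Therefore `u` and `v` are local coordinates over `W`
(`isLocalCoordinates_of_mvPolynomial`). In the same way the curves `{u = 0}` and `{v = 0}` of a chart
are affine lines over `W` if they lie over `O` (`IsChart.bijective_mvPolynomial_one`), and
`{u = v = 0}` is a section over `W` (`IsChart.bijective_quotient_span_range`).

The component `E i` is the closure of `{u = 0}` in the chart `i` and coincides with `{v = 0}` in the
chart `i - 1`. That it has no further equations there is the fact that `u` is a non-zero-divisor
modulo `v` (`IsChart.dvd_of_dvd_mul`). Likewise the proper transform of `C` is `{v = 0}` in the last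
chart. In these terms the divisor of `s = u ^ k v ^ (k + 1)`, the normal crossing property and the
intersections are read off chart by chart. An exceptional component is the union of two affine lines
over `W` that meet fibrewise, hence it has geometrically irreducible fibres
(`geometricallyIrreducible_of_sup_eq_top`); it is proper because it is closed in `X'` and lies over
`O`, which is a copy of `Spec W`. Finally, `C` is the zero locus of `s`, and outside it the first
chart contains all others and has the ring `R[1/s]`.
-/

noncomputable section

namespace AnSing

/-! ### Local coordinates for an adic topology -/

/-- Successive approximation: a ring homomorphism that is surjective modulo an extended ideal is
surjective modulo all its powers. -/
lemma exists_sub_mem_pow_of_exists_sub_mem {P B : Type*} [CommRing P] [CommRing B] (q : P →+* B)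
    (a : Ideal P) (h : ∀ b, ∃ p, b - q p ∈ a.map q) (m : ℕ) (b : B) :
    ∃ p, b - q p ∈ (a.map q) ^ m := by
  induction m generalizing b with
  | zero => exact ⟨0, by simp⟩
  | succ m ih =>
    obtain ⟨p, hp⟩ := ih b
    suffices H : ∀ z ∈ (a.map q) ^ m, ∃ p, z - q p ∈ (a.map q) ^ (m + 1) by
      obtain ⟨p', hp'⟩ := H _ hp
      exact ⟨p + p', by rw [map_add]; convert hp' using 1; ring⟩
    intro z hz
    rw [← Ideal.map_pow] at hz
    induction hz using Submodule.span_induction with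
    | mem z hz =>
      obtain ⟨t, ht, rfl⟩ := hz
      exact ⟨t, by simp⟩
    | zero => exact ⟨0, by simp⟩
    | add z z' _ _ h1 h2 =>
      obtain ⟨p, hp⟩ := h1
      obtain ⟨p', hp'⟩ := h2
      refine ⟨p + p', ?_⟩
      rw [map_add, add_sub_add_comm]
      exact add_mem hp hp'
    | smul c z hz h1 =>
      obtain ⟨p, hp⟩ := h1
      obtain ⟨r, hr⟩ := h c
      refine ⟨r * p, ?_⟩
      have hz' : z ∈ (a.map q) ^ m := by rw [← Ideal.map_pow]; exact hz
      have : c • z - q (r * p) = (c - q r) * z + q r * (z - q p) := by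
        rw [map_mul, smul_eq_mul]; ring
      rw [this]
      refine add_mem ?_ (Ideal.mul_mem_left _ _ hp)
      rw [pow_succ']
      exact Ideal.mul_mem_mul hr hz'

/-- If `q : W[T₁, …, T_d] → B` induces isomorphisms modulo all powers of a finitely generated
ideal, the images of the variables are local coordinates. -/
theorem isLocalCoordinates_of_mvPolynomial {W B : Type u} [CommRing W] [CommRing B] {d : ℕ}
    (q : MvPolynomial (Fin d) W →+* B) (a : Ideal (MvPolynomial (Fin d) W)) (ha : a.FG)
    (hsurj : ∀ b, ∃ p, b - q p ∈ a.map q) (hinj : ∀ m p, q p ∈ (a.map q) ^ m → p ∈ a ^ m) :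
    IsLocalCoordinates (q.comp MvPolynomial.C) (a.map q) (fun i ↦ q (MvPolynomial.X i)) := by
  have hsurj' (m : ℕ) :
      Function.Surjective ((Ideal.Quotient.mk ((a.map q) ^ m)).comp q) := by
    intro b
    obtain ⟨b, rfl⟩ := Ideal.Quotient.mk_surjective b
    obtain ⟨p, hp⟩ := exists_sub_mem_pow_of_exists_sub_mem q a hsurj m b
    exact ⟨p, (Ideal.Quotient.eq.mpr hp).symm⟩
  refine ⟨?_, ?_⟩
  · rw [← RingHom.comp_assoc]
    refine RingHom.FinitePresentation.comp (RingHom.FinitePresentation.of_surjective _ ?_ ?_) ?_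
    · intro b
      obtain ⟨b, rfl⟩ := Ideal.Quotient.mk_surjective b
      obtain ⟨p, hp⟩ := hsurj b
      exact ⟨p, (Ideal.Quotient.eq.mpr hp).symm⟩
    · have : RingHom.ker ((Ideal.Quotient.mk (a.map q)).comp q) = a := by
        ext p
        simp only [RingHom.mem_ker, RingHom.comp_apply, Ideal.Quotient.eq_zero_iff_mem]
        exact ⟨fun h ↦ by simpa using hinj 1 p (by simpa using h), Ideal.mem_map_of_mem q⟩
      rw [this]
      exact ha
    · exact (RingHom.finitePresentation_algebraMap (A := W)
        (B := MvPolynomial (Fin d) W)).mpr inferInstance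
  intro C _ ψ N hN f hf ⟨k, hk⟩ c hc
  let h : MvPolynomial (Fin d) W →+* C := MvPolynomial.eval₂Hom ψ c
  have hhf : (Ideal.Quotient.mk N).comp h = f.comp q := by
    ext i
    · simpa [h] using (RingHom.congr_fun hf i).symm
    · simpa [h] using (hc i).symm
  have hfa : ∀ p ∈ a ^ k, h p ∈ N := by
    intro p hp
    rw [← Ideal.Quotient.eq_zero_iff_mem]
    refine (RingHom.congr_fun hhf p).trans ?_
    refine hk ?_
    rw [← Ideal.map_pow]
    exact Ideal.mem_map_of_mem q hp
  -- the homomorphism `h` given by `ψ` and `c` factors through `B` modulo `I ^ (2 k)`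
  have hker : ∀ p ∈ a ^ (k + k), h p = 0 := by
    intro p hp
    have : h p ∈ N ^ 2 := by
      rw [pow_two]
      have := Ideal.mem_map_of_mem h hp
      rw [pow_add, Ideal.map_mul] at this
      exact Ideal.mul_mono (Ideal.map_le_iff_le_comap.mpr hfa)
        (Ideal.map_le_iff_le_comap.mpr hfa) this
    simpa [hN] using this
  -- a lift of `f` kills `I ^ (2 k)`, because it maps `I ^ k` to the square-zero ideal `N`
  have hlift (g : B →+* C) (hg : (Ideal.Quotient.mk N).comp g = f) :
      ∀ b ∈ (a.map q) ^ (k + k), g b = 0 := by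
    have h1 : ((a.map q) ^ k).map g ≤ N := by
      refine Ideal.map_le_iff_le_comap.mpr fun b hb ↦ ?_
      rw [Ideal.mem_comap, ← Ideal.Quotient.eq_zero_iff_mem]
      exact (RingHom.congr_fun hg b).trans (hk hb)
    intro b hb
    have : g b ∈ N ^ 2 := by
      rw [pow_two]
      have := Ideal.mem_map_of_mem g hb
      rw [pow_add, Ideal.map_mul] at this
      exact Ideal.mul_mono h1 h1 this
    simpa [hN] using this
  have hle : RingHom.ker ((Ideal.Quotient.mk ((a.map q) ^ (k + k))).comp q) ≤ RingHom.ker h := by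
    intro p hp
    rw [RingHom.mem_ker, RingHom.comp_apply, Ideal.Quotient.eq_zero_iff_mem] at hp
    exact hker p (hinj _ p hp)
  let g : B →+* C := (RingHom.liftOfSurjective _ (hsurj' (k + k)) ⟨h, hle⟩).comp
    (Ideal.Quotient.mk _)
  have hgq : g.comp q = h := by
    refine RingHom.ext fun p ↦ ?_
    exact RingHom.liftOfRightInverse_comp_apply _ _
      (Function.rightInverse_surjInv (hsurj' (k + k))) ⟨h, hle⟩ p
  refine ⟨g, ⟨?_, ?_, ?_⟩, ?_⟩
  · rw [← RingHom.comp_assoc, hgq]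
    ext w
    simp [h]
  · intro i
    rw [← RingHom.comp_apply, hgq]
    simp [h]
  · ext b
    obtain ⟨p, hp⟩ := exists_sub_mem_pow_of_exists_sub_mem q a hsurj (k + k) b
    have h1 : g b = g (q p) := by
      simp only [g, RingHom.comp_apply, Ideal.Quotient.eq.mpr hp]
    have h2 : f b = f (q p) := by
      rw [← sub_eq_zero, ← map_sub]
      exact hk (Ideal.pow_le_pow_right (Nat.le_add_right k k) hp)
    rw [RingHom.comp_apply, h1, h2, ← RingHom.comp_apply g, hgq, ← RingHom.comp_apply,
      hhf, RingHom.comp_apply]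
  · rintro g' ⟨h1, h2, h3⟩
    have hq' : g'.comp q = h := by
      ext i
      · simpa [h] using RingHom.congr_fun h1 i
      · simpa [h] using h2 i
    ext b
    obtain ⟨p, hp⟩ := exists_sub_mem_pow_of_exists_sub_mem q a hsurj (k + k) b
    have h4 : g' b = g' (q p) := by
      rw [← sub_eq_zero, ← map_sub]
      exact hlift g' h3 _ hp
    have h5 : g b = g (q p) := by
      simp only [g, RingHom.comp_apply, Ideal.Quotient.eq.mpr hp]
    rw [h4, h5, ← RingHom.comp_apply, ← RingHom.comp_apply, hq', hgq]

/-- Local coordinates restrict to local coordinates on the zero locus of one of them. -/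
theorem IsLocalCoordinates.of_surjective {W B B' : Type u} [CommRing W] [CommRing B] [CommRing B']
    {φ : W →+* B} {I : Ideal B} {d : ℕ} {x : Fin (d + 1) → B} (h : IsLocalCoordinates φ I x)
    (j : Fin (d + 1)) (π : B →+* B') (hπ : Function.Surjective π)
    (hker : RingHom.ker π = Ideal.span {x j}) :
    IsLocalCoordinates (π.comp φ) (I.map π) (fun i ↦ π (x (j.succAbove i))) := by
  obtain ⟨hfp, hlift⟩ := h
  refine ⟨?_, ?_⟩
  · let σ : B ⧸ I →+* B' ⧸ I.map π := Ideal.quotientMap _ π Ideal.le_comap_map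
    have hσ : Function.Surjective σ := Ideal.quotientMap_surjective hπ
    have : (Ideal.Quotient.mk (I.map π)).comp (π.comp φ) =
        σ.comp ((Ideal.Quotient.mk I).comp φ) := by
      ext w; simp [σ]
    rw [this]
    refine RingHom.FinitePresentation.comp (RingHom.FinitePresentation.of_surjective _ hσ ?_) hfp
    refine ⟨{Ideal.Quotient.mk I (x j)}, ?_⟩
    have hx : π (x j) = 0 := by
      rw [← RingHom.mem_ker, hker]; exact Ideal.mem_span_singleton_self _
    apply le_antisymm
    · rw [Finset.coe_singleton, Ideal.span_singleton_le_iff_mem]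
      simp [σ, hx]
    · intro b hb
      obtain ⟨b, rfl⟩ := Ideal.Quotient.mk_surjective b
      rw [RingHom.mem_ker, Ideal.quotientMap_mk, Ideal.Quotient.eq_zero_iff_mem,
        Ideal.mem_map_iff_of_surjective π hπ] at hb
      obtain ⟨z, hz, hzb⟩ := hb
      have : b - z ∈ RingHom.ker π := by rw [RingHom.mem_ker, map_sub, hzb, sub_self]
      rw [hker, Ideal.mem_span_singleton'] at this
      obtain ⟨c, hc⟩ := this
      rw [Finset.coe_singleton, Ideal.mem_span_singleton']
      refine ⟨Ideal.Quotient.mk I c, ?_⟩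
      rw [← map_mul, hc, map_sub, Ideal.Quotient.eq_zero_iff_mem.mpr hz, sub_zero]
  intro C _ ψ N hN f hf ⟨k, hk⟩ c hc
  obtain ⟨g, ⟨h1, h2, h3⟩, huniq⟩ := hlift C ψ N hN (f.comp π) (by rw [RingHom.comp_assoc, hf])
    ⟨k, fun b hb ↦ hk (by rw [← Ideal.map_pow]; exact Ideal.mem_map_of_mem π hb)⟩
    -- the coordinate which vanishes on the zero locus is lifted to `0`
    (j.insertNth 0 c) (by
      intro i
      refine j.succAboveCases ?_ (fun i ↦ ?_) i
      · have : π (x j) = 0 := by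
          rw [← RingHom.mem_ker, hker]; exact Ideal.mem_span_singleton_self _
        simp [this]
      · simpa using hc i)
  have hg : RingHom.ker π ≤ RingHom.ker g := by
    rw [hker, Ideal.span_singleton_le_iff_mem, RingHom.mem_ker, h2 j]
    simp
  have hgπ : ∀ b, RingHom.liftOfSurjective π hπ ⟨g, hg⟩ (π b) = g b :=
    RingHom.liftOfRightInverse_comp_apply _ _ (Function.rightInverse_surjInv hπ) ⟨g, hg⟩
  refine ⟨RingHom.liftOfSurjective π hπ ⟨g, hg⟩, ⟨?_, ?_, ?_⟩, ?_⟩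
  · ext w
    simpa [hgπ] using RingHom.congr_fun h1 w
  · intro i
    rw [hgπ, h2]
    simp
  · ext b
    obtain ⟨b, rfl⟩ := hπ b
    simpa [hgπ] using RingHom.congr_fun h3 b
  · rintro g' ⟨h1', h2', h3'⟩
    have := huniq (g'.comp π) ⟨by rw [RingHom.comp_assoc, h1'], by
      intro i
      refine j.succAboveCases ?_ (fun i ↦ ?_) i
      · have : π (x j) = 0 := by
          rw [← RingHom.mem_ker, hker]; exact Ideal.mem_span_singleton_self _
        simp [this]
      · simpa using h2' i, by rw [← RingHom.comp_assoc, h3']⟩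
    ext b
    obtain ⟨b, rfl⟩ := hπ b
    rw [hgπ, ← this, RingHom.comp_apply]

/-! ### Monomial ideals and power series -/

/-- A power series without monomials prime to the variables in `S` lies in the ideal generated
by these variables. -/
lemma mem_span_X_of_coeff_eq_zero {σ W : Type*} [CommRing W] (S : Finset σ)
    (F : MvPowerSeries σ W)
    (h : ∀ m : σ →₀ ℕ, (∀ i ∈ S, m i = 0) → MvPowerSeries.coeff m F = 0) :
    F ∈ Ideal.span ((MvPowerSeries.X : σ → MvPowerSeries σ W) '' (S : Set σ)) := by
  classical
  induction S using Finset.induction_on generalizing F with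
  | empty =>
    have : F = 0 := by ext m; exact h m (by simp)
    simp [this]
  | insert i S hi ih =>
    let F₁ : MvPowerSeries σ W := fun m ↦ if m i = 0 then MvPowerSeries.coeff m F else 0
    have hF₁ (m) : MvPowerSeries.coeff m F₁ = if m i = 0 then MvPowerSeries.coeff m F else 0 :=
      rfl
    have h1 : F₁ ∈ Ideal.span ((MvPowerSeries.X : σ → MvPowerSeries σ W) '' (S : Set σ)) := by
      refine ih F₁ fun m hm ↦ ?_
      rw [hF₁]
      split_ifs with h0
      · exact h m (by simpa [h0] using hm)
      · rfl
    have h2 : (MvPowerSeries.X i : MvPowerSeries σ W) ∣ F - F₁ := by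
      rw [MvPowerSeries.X_dvd_iff]
      intro m hm
      rw [map_sub, hF₁, if_pos hm, sub_self]
    have h3 := Ideal.span_mono (Set.image_mono (f := (MvPowerSeries.X : σ → MvPowerSeries σ W))
      (Finset.coe_subset.mpr (Finset.subset_insert i S))) h1
    rw [← sub_add_cancel F F₁]
    refine add_mem (Ideal.mem_of_dvd _ h2 (Ideal.subset_span ⟨i, by simp, rfl⟩)) h3

/-- The ideal of `W[T]` generated by a set of monomials. -/
def monomialIdeal {σ : Type*} (W : Type*) [CommRing W] (S : Set (σ →₀ ℕ)) :
    Ideal (MvPolynomial σ W) :=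
  Ideal.span ((fun m ↦ MvPolynomial.monomial m (1 : W)) '' S)

open Pointwise in
/-- Powers of monomial ideals are monomial ideals. -/
lemma exists_monomialIdeal_pow {σ W : Type*} [CommRing W] (S : Set (σ →₀ ℕ)) (m : ℕ) :
    ∃ T, monomialIdeal W S ^ m = monomialIdeal W T := by
  induction m with
  | zero => exact ⟨{0}, by simp [monomialIdeal, ← Ideal.one_eq_top]⟩
  | succ m ih =>
    obtain ⟨T, hT⟩ := ih
    refine ⟨T + S, ?_⟩
    rw [pow_succ, hT, monomialIdeal, monomialIdeal, monomialIdeal, Ideal.span_mul_span']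
    congr 1
    ext p
    simp only [Set.mem_mul, Set.mem_image, Set.mem_add]
    constructor
    · rintro ⟨_, ⟨a, ha, rfl⟩, _, ⟨b, hb, rfl⟩, rfl⟩
      exact ⟨a + b, ⟨a, ha, b, hb, rfl⟩, by simp [MvPolynomial.monomial_mul]⟩
    · rintro ⟨_, ⟨a, ha, b, hb, rfl⟩, rfl⟩
      exact ⟨_, ⟨a, ha, rfl⟩, _, ⟨b, hb, rfl⟩, by simp [MvPolynomial.monomial_mul]⟩

/-- A monomial ideal of the polynomial ring is contracted from the power series ring. -/
lemma mem_monomialIdeal_of_coe_mem {σ W : Type*} [CommRing W] (S : Set (σ →₀ ℕ))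
    (p : MvPolynomial σ W)
    (h : (p : MvPowerSeries σ W) ∈
      (monomialIdeal W S).map (MvPolynomial.coeToMvPowerSeries.ringHom (R := W) (σ := σ))) :
    p ∈ monomialIdeal W S := by
  classical
  have key : ∀ F ∈ (monomialIdeal W S).map (MvPolynomial.coeToMvPowerSeries.ringHom (R := W)
      (σ := σ)), ∀ m, MvPowerSeries.coeff m F ≠ 0 → ∃ s ∈ S, s ≤ m := by
    intro F hF
    rw [monomialIdeal, Ideal.map_span] at hF
    induction hF using Submodule.span_induction with
    | mem F hF =>
      obtain ⟨_, ⟨s, hs, rfl⟩, rfl⟩ := hF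
      intro m hm
      refine ⟨s, hs, ?_⟩
      by_contra hne
      apply hm
      simp only [MvPolynomial.coeToMvPowerSeries.ringHom_apply, MvPolynomial.coeff_coe,
        MvPolynomial.coeff_monomial]
      rw [if_neg]
      rintro rfl
      exact hne le_rfl
    | zero => intro m hm; simp at hm
    | add F G _ _ h1 h2 =>
      intro m hm
      by_cases h : MvPowerSeries.coeff m F = 0
      · exact h2 m (by rw [map_add, h, zero_add] at hm; exact hm)
      · exact h1 m h
    | smul G F _ h1 =>
      intro m hm
      rw [smul_eq_mul, MvPowerSeries.coeff_mul] at hm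
      obtain ⟨⟨i, j⟩, hij, hne⟩ := Finset.exists_ne_zero_of_sum_ne_zero hm
      obtain ⟨s, hs, hsj⟩ := h1 j (right_ne_zero_of_mul hne)
      refine ⟨s, hs, hsj.trans ?_⟩
      rw [← Finset.HasAntidiagonal.mem_antidiagonal.mp hij]
      exact le_add_self
  rw [monomialIdeal, MvPolynomial.mem_ideal_span_monomial_image]
  intro m hm
  exact key _ h m (by simpa using hm)

/-! ### The ring of the singularity -/

section Singularity

variable {W : Type u} [CommRing W] {n : ℕ}

lemma coord_relation : coord W n 2 * coord W n 0 = coord W n 1 ^ n := by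
  rw [← sub_eq_zero, coord, coord, coord, ← map_mul, ← map_pow, ← map_sub,
    Ideal.Quotient.eq_zero_iff_mem]
  exact Ideal.mem_span_singleton_self _

/-- The ideal of the origin. -/
def originIdeal (W : Type u) [CommRing W] (n : ℕ) : Ideal (R W n) :=
  Ideal.span {coord W n 0, coord W n 1, coord W n 2}

/-- Every function on `X` is constant modulo the ideal of the origin. -/
lemma exists_sub_algebraMap_mem_originIdeal (r : R W n) :
    ∃ w, r - algebraMap W (R W n) w ∈ originIdeal W n := by
  obtain ⟨F, rfl⟩ := Ideal.Quotient.mk_surjective r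
  refine ⟨MvPowerSeries.constantCoeff F, ?_⟩
  have h : F - MvPowerSeries.C (MvPowerSeries.constantCoeff F) ∈
      Ideal.span ((MvPowerSeries.X : Fin 3 → PS W) '' ((Finset.univ : Finset (Fin 3)) : Set _)) := by
    refine mem_span_X_of_coeff_eq_zero _ _ fun m hm ↦ ?_
    have : m = 0 := by ext i; exact hm i (Finset.mem_univ i)
    subst this
    simp
  have h2 := Ideal.mem_map_of_mem (Ideal.Quotient.mk (Ideal.span
    {(MvPowerSeries.X 2 * MvPowerSeries.X 0 - MvPowerSeries.X 1 ^ n : PS W)})) h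
  rw [Ideal.map_span, map_sub] at h2
  refine Ideal.span_le.mpr ?_ h2
  rintro _ ⟨_, ⟨i, -, rfl⟩, rfl⟩
  refine Ideal.subset_span ?_
  fin_cases i
  · exact Or.inl rfl
  · exact Or.inr (Or.inl rfl)
  · exact Or.inr (Or.inr rfl)

/-- `y` is a non-zero-divisor: modulo `y`, the equation `s x - y ^ n` becomes the
non-zero-divisor `s x`. -/
lemma coord_one_mem_nonZeroDivisors (hn : 0 < n) : coord W n 1 ∈ nonZeroDivisors (R W n) := by
  rw [mem_nonZeroDivisors_iff_right]
  intro r hr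
  obtain ⟨F, rfl⟩ := Ideal.Quotient.mk_surjective r
  rw [coord, ← map_mul, Ideal.Quotient.eq_zero_iff_mem, Ideal.mem_span_singleton] at hr
  rw [Ideal.Quotient.eq_zero_iff_mem, Ideal.mem_span_singleton]
  obtain ⟨G, hG⟩ := hr
  have hX : (MvPowerSeries.X 1 : PS W) ∣ G := by
    have h1 : (MvPowerSeries.X 1 : PS W) ∣ MvPowerSeries.X 2 * (MvPowerSeries.X 0 * G) := by
      have : (MvPowerSeries.X 2 * (MvPowerSeries.X 0 * G) : PS W) =
          F * MvPowerSeries.X 1 + MvPowerSeries.X 1 ^ n * G := by rw [hG]; ring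
      rw [this]
      exact dvd_add (Dvd.intro_left _ rfl) ((dvd_pow_self _ hn.ne').mul_right _)
    rw [MvPowerSeries.X_dvd_iff] at h1 ⊢
    intro m hm
    have := h1 (Finsupp.single 2 1 + (Finsupp.single 0 1 + m)) (by simp [hm])
    rwa [MvPowerSeries.X, MvPowerSeries.X, MvPowerSeries.coeff_add_monomial_mul, one_mul,
      MvPowerSeries.coeff_add_monomial_mul, one_mul] at this
  obtain ⟨G', rfl⟩ := hX
  refine ⟨G', ?_⟩
  rw [← sub_eq_zero]
  refine (mem_nonZeroDivisors_iff_right.mp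
    (MvPowerSeries.X_mem_nonzeroDivisors (i := (1 : Fin 3)) (R := W))) _ ?_
  rw [sub_mul, hG]
  ring

end Singularity

/-! ### The rings of the charts -/

/-- The functions `x`, `y`, `s` as monomials in the coordinates `u`, `v` of the `k`-th chart, which
are the variables `0` and `1`. -/
def chartMonomial (W : Type u) [CommRing W] (n k : ℕ) : Fin 3 → MvPowerSeries (Fin 2) W :=
  ![MvPowerSeries.X 0 ^ (n - k) * MvPowerSeries.X 1 ^ (n - k - 1),
    MvPowerSeries.X 0 * MvPowerSeries.X 1,
    MvPowerSeries.X 0 ^ k * MvPowerSeries.X 1 ^ (k + 1)]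

lemma hasSubst_chartMonomial (W : Type u) [CommRing W] {n k : ℕ} (hk : k < n) :
    MvPowerSeries.HasSubst (chartMonomial W n k) := by
  refine MvPowerSeries.hasSubst_of_constantCoeff_zero fun i ↦ ?_
  have : n - k ≠ 0 := by omega
  fin_cases i <;> simp [chartMonomial, this]

/-- `B` is the coordinate ring of the `k`-th chart of the resolution, with coordinates
`u = x 0` and `v = x 1`. It is generated by `u` and `v` over the ring of the singularity, and it
has a homomorphism to `W[[u, v]]` (the completion at the origin of the chart) that sends
`u`, `v` to the variables. -/
structure IsChart {W : Type u} [CommRing W] {n : ℕ} (k : ℕ) {B : Type u} [CommRing B]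
    (φ : R W n →+* B) (x : Fin 2 → B) : Prop where
  lt : k < n
  map_x : φ (coord W n 0) = x 0 ^ (n - k) * x 1 ^ (n - k - 1)
  map_y : φ (coord W n 1) = x 0 * x 1
  map_s : φ (coord W n 2) = x 0 ^ k * x 1 ^ (k + 1)
  mem_nonZeroDivisors (i : Fin 2) : x i ∈ nonZeroDivisors B
  surjective : Function.Surjective (MvPolynomial.eval₂Hom φ x)
  exists_toPowerSeries : ∃ ψ : B →+* MvPowerSeries (Fin 2) W, (∀ i, ψ (x i) = MvPowerSeries.X i) ∧
    ∀ F : PS W, ψ (φ (Ideal.Quotient.mk _ F)) = MvPowerSeries.subst (chartMonomial W n k) F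

/-- A subring of `R[1/y]` generated over `R` by `u = y ^ (k + 1) / s` and `v = s / y ^ k` is the
ring of the `k`-th chart. -/
theorem IsChart.of_injective {W : Type u} [CommRing W] {n k : ℕ} (hk : k < n)
    {B : Type u} [CommRing B] {L : Type u} [CommRing L] [Algebra (R W n) L]
    [IsLocalization.Away (coord W n 1) L] (φ : R W n →+* B) (x : Fin 2 → B)
    (θ : B →+* L) (hθ : Function.Injective θ) (hθφ : θ.comp φ = algebraMap (R W n) L)
    (h0 : x 0 * φ (coord W n 2) = φ (coord W n 1) ^ (k + 1))
    (h1 : x 1 * φ (coord W n 1) ^ k = φ (coord W n 2))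
    (hx : Function.Surjective (MvPolynomial.eval₂Hom φ x)) : IsChart k φ x := by
  set X : L := θ (φ (coord W n 0)) with hX
  set Y : L := θ (φ (coord W n 1)) with hY
  set S : L := θ (φ (coord W n 2)) with hS
  have hyu : IsUnit Y := by
    have := IsLocalization.Away.algebraMap_isUnit (coord W n 1) (S := L)
    rwa [← hθφ] at this
  have hsx : S * X = Y ^ n := by
    rw [hS, hX, hY, ← map_mul, ← map_mul, ← map_pow, ← map_pow, coord_relation]
  have hsu : IsUnit S := isUnit_of_mul_isUnit_left (hsx ▸ hyu.pow n)
  have hu : θ (x 0) * S = Y ^ (k + 1) := by rw [hS, ← map_mul, h0]; simp [hY]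
  have hv : θ (x 1) * Y ^ k = S := by rw [hS, ← h1]; simp [hY]
  have huu : IsUnit (θ (x 0)) := isUnit_of_mul_isUnit_left (hu ▸ hyu.pow _)
  have hvu : IsUnit (θ (x 1)) := isUnit_of_mul_isUnit_left (hv ▸ hsu)
  have huv : θ (x 0) * θ (x 1) = Y := by
    refine (hyu.pow k).mul_right_cancel ?_
    rw [mul_assoc, hv, hu, pow_succ']
  have hs : S = θ (x 0) ^ k * θ (x 1) ^ (k + 1) := by
    rw [← hv, ← huv]; ring
  refine ⟨hk, hθ ?_, hθ ?_, hθ ?_, ?_, hx, ?_⟩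
  · refine hsu.mul_left_cancel ?_
    rw [← hX, hsx, hs, ← huv, map_mul, map_pow, map_pow, mul_pow]
    have e1 : n = k + (n - k) := by omega
    have e2 : n = (k + 1) + (n - k - 1) := by omega
    calc θ (x 0) ^ n * θ (x 1) ^ n
        = θ (x 0) ^ (k + (n - k)) * θ (x 1) ^ ((k + 1) + (n - k - 1)) := by rw [← e1, ← e2]
      _ = _ := by rw [pow_add, pow_add]; ring
  · rw [← hY, map_mul, huv]
  · rw [← hS, hs]; simp
  · intro i
    rw [mem_nonZeroDivisors_iff_right]
    intro b hb
    apply hθ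
    have hiu : IsUnit (θ (x i)) := by fin_cases i <;> assumption
    refine hiu.mul_right_cancel ?_
    rw [← map_mul, hb]; simp
  -- the homomorphism to power series is the restriction of `R[1/y] → W[[u, v]][1/(u v)]`
  let P := MvPowerSeries (Fin 2) W
  let t : P := MvPowerSeries.X 0 * MvPowerSeries.X 1
  have ht : t ∈ nonZeroDivisors P := mul_mem MvPowerSeries.X_mem_nonzeroDivisors
    MvPowerSeries.X_mem_nonzeroDivisors
  let ι : P →+* Localization.Away t := algebraMap _ _
  have hι : Function.Injective ι := IsLocalization.injective _ (Submonoid.powers_le.mpr ht)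
  have htu : IsUnit (ι t) := IsLocalization.Away.algebraMap_isUnit t
  let σ : PS W →+* P := (MvPowerSeries.substAlgHom (R := W) (hasSubst_chartMonomial W hk)).toRingHom
  have hσ (F) : σ F = MvPowerSeries.subst (chartMonomial W n k) F :=
    MvPowerSeries.substAlgHom_apply _ F
  have hσX (i) : σ (MvPowerSeries.X i) = chartMonomial W n k i := by
    rw [hσ, MvPowerSeries.subst_X (hasSubst_chartMonomial W hk)]
  have hσ0 : ∀ F ∈ Ideal.span
      {(MvPowerSeries.X 2 * MvPowerSeries.X 0 - MvPowerSeries.X 1 ^ n : PS W)}, σ F = 0 := by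
    intro F hF
    obtain ⟨G, rfl⟩ := Ideal.mem_span_singleton.mp hF
    rw [map_mul, map_sub, map_mul, map_pow, hσX, hσX, hσX]
    simp only [chartMonomial, Matrix.cons_val]
    have e1 : n = k + (n - k) := by omega
    have e2 : n = (k + 1) + (n - k - 1) := by omega
    have : (MvPowerSeries.X 0 * MvPowerSeries.X 1 : P) ^ n =
        MvPowerSeries.X 0 ^ (k + (n - k)) * MvPowerSeries.X 1 ^ ((k + 1) + (n - k - 1)) := by
      rw [← e1, ← e2, mul_pow]
    rw [this, pow_add, pow_add]
    ring
  let σ' : R W n →+* P := Ideal.Quotient.lift _ σ hσ0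
  have hσ'X (i) : σ' (coord W n i) = chartMonomial W n k i := by rw [← hσX]; rfl
  have hσ'y : σ' (coord W n 1) = t := hσ'X 1
  let Φ : L →+* Localization.Away t := IsLocalization.Away.lift (coord W n 1) (g := ι.comp σ')
    (by rw [RingHom.comp_apply, hσ'y]; exact htu)
  have hΦ (a) : Φ (θ (φ a)) = ι (σ' a) := by
    rw [← RingHom.comp_apply θ, hθφ]
    exact IsLocalization.Away.lift_eq _ _ a
  have h1u : IsUnit (ι (MvPowerSeries.X 1)) :=
    isUnit_of_mul_isUnit_right (by rw [← map_mul]; exact htu)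
  have hΦv : Φ (θ (x 1)) = ι (MvPowerSeries.X 1) := by
    have := congr(Φ $hv)
    rw [map_mul, map_pow, hY, hS, hΦ, hΦ, hσ'X, hσ'X] at this
    refine (htu.pow k).mul_right_cancel ?_
    refine this.trans ?_
    rw [← map_pow, ← map_mul]
    congr 1
    simp only [chartMonomial, Matrix.cons_val, t]
    ring
  have hΦu : Φ (θ (x 0)) = ι (MvPowerSeries.X 0) := by
    have := congr(Φ $huv)
    rw [map_mul, hY, hΦ, hσ'X, hΦv] at this
    refine h1u.mul_right_cancel ?_
    rw [this, ← map_mul]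
    rfl
  have hrange (b : B) : Φ (θ b) ∈ ι.range := by
    obtain ⟨p, rfl⟩ := hx b
    induction p using MvPolynomial.induction_on with
    | C a => exact ⟨σ' a, by simp [hΦ]⟩
    | add p q hp hq =>
      rw [map_add, map_add, map_add]
      exact add_mem hp hq
    | mul_X p i hp =>
      rw [map_mul, map_mul, map_mul]
      refine mul_mem hp ?_
      fin_cases i
      · exact ⟨MvPowerSeries.X 0, by simp [hΦu]⟩
      · exact ⟨MvPowerSeries.X 1, by simp [hΦv]⟩
  let e : P ≃+* ι.range := RingEquiv.ofBijective ι.rangeRestrict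
    ⟨fun a b h ↦ hι congr(($h).1), ι.rangeRestrict_surjective⟩
  let ψ : B →+* P := e.symm.toRingHom.comp ((Φ.comp θ).codRestrict ι.range hrange)
  have hψ (b) (p) (h : Φ (θ b) = ι p) : ψ b = p := by
    refine (RingEquiv.symm_apply_eq e).mpr (Subtype.ext h)
  refine ⟨ψ, fun i ↦ hψ _ _ (by fin_cases i <;> assumption), fun F ↦ hψ _ _ ?_⟩
  rw [hΦ, ← hσ]
  rfl

/-! ### Functions on a chart -/

namespace IsChart

variable {W : Type u} [CommRing W] {n k : ℕ} {B : Type u} [CommRing B] {φ : R W n →+* B}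
  {x : Fin 2 → B}

/-- The homomorphism `W[u, v] → B` given by the coordinates of a chart. -/
def ofMvPolynomial (φ : R W n →+* B) (x : Fin 2 → B) : MvPolynomial (Fin 2) W →+* B :=
  MvPolynomial.eval₂Hom (φ.comp (algebraMap W (R W n))) x

@[simp] lemma ofMvPolynomial_X (i : Fin 2) : ofMvPolynomial φ x (.X i) = x i := by
  simp [ofMvPolynomial]

@[simp] lemma ofMvPolynomial_C (w : W) :
    ofMvPolynomial φ x (.C w) = φ (algebraMap W (R W n) w) := by
  simp [ofMvPolynomial]

/-- Exponents of the monomials `x`, `y`, `s` in the coordinates of the `k`-th chart. -/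
def exponents (n k : ℕ) : Set (Fin 2 →₀ ℕ) :=
  {.single 0 (n - k) + .single 1 (n - k - 1), .single 0 1 + .single 1 1,
    .single 0 k + .single 1 (k + 1)}

lemma ofMvPolynomial_monomial (a b : ℕ) :
    ofMvPolynomial φ x (.monomial (.single 0 a + .single 1 b) 1) = x 0 ^ a * x 1 ^ b := by
  rw [← mul_one (1 : W), ← MvPolynomial.monomial_mul, map_mul]
  simp [ofMvPolynomial]

lemma map_originIdeal (h : IsChart k φ x) :
    (originIdeal W n).map φ = (monomialIdeal W (exponents n k)).map (ofMvPolynomial φ x) := by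
  rw [originIdeal, monomialIdeal, Ideal.map_span, Ideal.map_span]
  congr 1
  simp only [exponents, Set.image_insert_eq, Set.image_singleton, ofMvPolynomial_monomial,
    h.map_x, h.map_y, h.map_s, pow_one]

lemma map_originIdeal_le_span {b : B} (h0 : b ∣ φ (coord W n 0))
    (h1 : b ∣ φ (coord W n 1)) (h2 : b ∣ φ (coord W n 2)) :
    (originIdeal W n).map φ ≤ Ideal.span {b} := by
  rw [originIdeal, Ideal.map_span, Ideal.span_le]
  rintro _ ⟨_, rfl | rfl | rfl, rfl⟩ <;> simpa [Ideal.mem_span_singleton]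

/-- The origin lies in the zero locus of `u`, except in the first chart. -/
lemma map_originIdeal_le_span_zero (h : IsChart k φ x) (hk : 0 < k) :
    (originIdeal W n).map φ ≤ Ideal.span {x 0} := by
  refine map_originIdeal_le_span ?_ ?_ ?_
  · rw [h.map_x]; exact (dvd_pow_self _ (by have := h.lt; omega)).mul_right _
  · rw [h.map_y]; exact Dvd.intro _ rfl
  · rw [h.map_s]; exact (dvd_pow_self _ hk.ne').mul_right _

/-- The origin lies in the zero locus of `v`, except in the last chart. -/
lemma map_originIdeal_le_span_one (h : IsChart k φ x) (hk : k + 1 < n) :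
    (originIdeal W n).map φ ≤ Ideal.span {x 1} := by
  refine map_originIdeal_le_span ?_ ?_ ?_
  · rw [h.map_x]; exact (dvd_pow_self _ (by omega)).mul_left _
  · rw [h.map_y]; exact Dvd.intro_left _ rfl
  · rw [h.map_s]; exact (dvd_pow_self _ (by omega)).mul_left _

lemma map_originIdeal_le_span_range (h : IsChart k φ x) :
    (originIdeal W n).map φ ≤ Ideal.span (Set.range x) := by
  have h0 : x 0 ∈ Ideal.span (Set.range x) := Ideal.subset_span ⟨0, rfl⟩
  have h1 : x 1 ∈ Ideal.span (Set.range x) := Ideal.subset_span ⟨1, rfl⟩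
  rw [originIdeal, Ideal.map_span, Ideal.span_le]
  rintro _ ⟨_, rfl | rfl | rfl, rfl⟩
  · rw [h.map_x]
    exact Ideal.mul_mem_right _ _ (Ideal.pow_mem_of_mem _ h0 _ (by have := h.lt; omega))
  · rw [h.map_y]; exact Ideal.mul_mem_right _ _ h0
  · rw [h.map_s]; exact Ideal.mul_mem_left _ _ (Ideal.pow_mem_of_mem _ h1 _ (by omega))

/-- Modulo the ideal of the origin, every function on a chart is a polynomial in the
coordinates. -/
lemma exists_sub_mem (h : IsChart k φ x) (b : B) :
    ∃ p, b - ofMvPolynomial φ x p ∈ (originIdeal W n).map φ := by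
  obtain ⟨P, rfl⟩ := h.surjective b
  induction P using MvPolynomial.induction_on with
  | C a =>
    obtain ⟨w, hw⟩ := exists_sub_algebraMap_mem_originIdeal a
    refine ⟨.C w, ?_⟩
    rw [ofMvPolynomial_C]
    simpa using Ideal.mem_map_of_mem φ hw
  | add P Q hP hQ =>
    obtain ⟨p, hp⟩ := hP
    obtain ⟨q, hq⟩ := hQ
    refine ⟨p + q, ?_⟩
    rw [map_add, map_add, add_sub_add_comm]
    exact add_mem hp hq
  | mul_X P i hP =>
    obtain ⟨p, hp⟩ := hP
    refine ⟨p * .X i, ?_⟩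
    rw [map_mul, map_mul, ofMvPolynomial_X, MvPolynomial.coe_eval₂Hom, MvPolynomial.eval₂_X,
      ← sub_mul]
    exact Ideal.mul_mem_right _ _ hp

/-- The homomorphism to power series restricts to the inclusion of the polynomials. -/
lemma exists_toPowerSeries' (h : IsChart k φ x) : ∃ ψ : B →+* MvPowerSeries (Fin 2) W,
    (∀ i, ψ (x i) = MvPowerSeries.X i) ∧
    (∀ F : PS W, ψ (φ (Ideal.Quotient.mk _ F)) =
      MvPowerSeries.subst (chartMonomial W n k) F) ∧
    ∀ p, ψ (ofMvPolynomial φ x p) = (p : MvPowerSeries (Fin 2) W) := by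
  obtain ⟨ψ, h1, h2⟩ := h.exists_toPowerSeries
  refine ⟨ψ, h1, h2, fun p ↦ ?_⟩
  suffices ψ.comp (ofMvPolynomial φ x) = MvPolynomial.coeToMvPowerSeries.ringHom from
    RingHom.congr_fun this p
  refine MvPolynomial.ringHom_ext (fun w ↦ ?_) (fun i ↦ ?_)
  · have : algebraMap W (R W n) w = Ideal.Quotient.mk _ (algebraMap W (PS W) w) := rfl
    simp only [RingHom.comp_apply, ofMvPolynomial_C, this, h2]
    rw [← MvPowerSeries.substAlgHom_apply (R := W) (hasSubst_chartMonomial W h.lt),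
      AlgHom.commutes]
    simp [MvPowerSeries.algebraMap_apply]
  · simp [h1]

/-- The coordinates of a chart are local coordinates over `W`. -/
theorem isLocalCoordinates (h : IsChart k φ x) :
    IsLocalCoordinates (φ.comp (algebraMap W (R W n))) ((originIdeal W n).map φ) x := by
  have := isLocalCoordinates_of_mvPolynomial (ofMvPolynomial φ x) (monomialIdeal W (exponents n k))
    (Submodule.fg_span (Set.Finite.image _ (by simp [exponents]))) (by
      rw [← h.map_originIdeal]; exact h.exists_sub_mem) (by
      intro m p hp
      obtain ⟨ψ, -, -, hψ⟩ := h.exists_toPowerSeries'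
      obtain ⟨T, hT⟩ := exists_monomialIdeal_pow (W := W) (exponents n k) m
      rw [hT]
      refine mem_monomialIdeal_of_coe_mem T p ?_
      rw [← hψ, ← hT]
      have h1 := Ideal.mem_map_of_mem ψ hp
      have h2 : ψ.comp (ofMvPolynomial φ x) = MvPolynomial.coeToMvPowerSeries.ringHom :=
        RingHom.ext hψ
      rwa [← Ideal.map_pow, Ideal.map_map, h2] at h1)
  rw [h.map_originIdeal]
  convert this using 1
  · ext w; simp
  · ext i; simp

/-- The zero locus of one coordinate is an affine line if it contains the origin. -/
theorem bijective_mvPolynomial_one (h : IsChart k φ x) (j : Fin 2)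
    (hj : (originIdeal W n).map φ ≤ Ideal.span {x j}) {B' : Type*} [CommRing B'] (π : B →+* B')
    (hπ : Function.Surjective π) (hker : RingHom.ker π = Ideal.span {x j}) :
    Function.Bijective (MvPolynomial.eval₂Hom (π.comp (φ.comp (algebraMap W (R W n))))
      (fun i : Fin 1 ↦ π (x (j.succAbove i)))) := by
  constructor
  · rw [injective_iff_map_eq_zero]
    intro p hp
    obtain ⟨ψ, hψX, -, hψ⟩ := h.exists_toPowerSeries'
    have h1 : π (ofMvPolynomial φ x (MvPolynomial.rename j.succAbove p)) = 0 := by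
      rw [← hp, ofMvPolynomial, MvPolynomial.eval₂Hom_rename, MvPolynomial.map_eval₂Hom]
      rfl
    rw [← RingHom.mem_ker, hker, Ideal.mem_span_singleton] at h1
    have h2 := map_dvd ψ h1
    rw [hψ, hψX, MvPowerSeries.X_dvd_iff] at h2
    ext m
    have h3 := h2 (m.mapDomain j.succAbove) (Finsupp.mapDomain_of_notMem_range _ _ (by simp))
    rw [MvPolynomial.coeff_coe,
      MvPolynomial.coeff_rename_mapDomain _ (Fin.succAbove_right_injective)] at h3
    simpa using h3
  · intro b
    obtain ⟨b, rfl⟩ := hπ b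
    obtain ⟨p, hp⟩ := h.exists_sub_mem b
    have hp' := hj hp
    rw [← hker, RingHom.mem_ker, map_sub, sub_eq_zero] at hp'
    refine ⟨MvPolynomial.aeval (j.insertNth 0 MvPolynomial.X) p, ?_⟩
    rw [hp', ← RingHom.comp_apply π]
    have hxj : π (x j) = 0 := by
      rw [← RingHom.mem_ker, hker]; exact Ideal.mem_span_singleton_self _
    refine RingHom.congr_fun (f := (MvPolynomial.eval₂Hom _ _).comp
      (MvPolynomial.aeval (R := W) _).toRingHom) (MvPolynomial.ringHom_ext ?_ ?_) p
    · simp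
    · intro i
      refine j.succAboveCases ?_ (fun i ↦ ?_) i
      · simp [hxj]
      · simp

/-- The zero locus of both coordinates is a section over `W`. -/
theorem bijective_quotient_span_range (h : IsChart k φ x) {B' : Type*} [CommRing B'] (π : B →+* B')
    (hπ : Function.Surjective π) (hker : RingHom.ker π = Ideal.span (Set.range x)) :
    Function.Bijective (π.comp (φ.comp (algebraMap W (R W n)))) := by
  have hx (i) : π (x i) = 0 := by
    rw [← RingHom.mem_ker, hker]; exact Ideal.subset_span ⟨i, rfl⟩
  constructor
  · rw [injective_iff_map_eq_zero]
    intro w hw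
    obtain ⟨ψ, hψX, -, hψ⟩ := h.exists_toPowerSeries'
    have h1 : ofMvPolynomial φ x (.C w) ∈ Ideal.span (Set.range x) := by
      rw [← hker, RingHom.mem_ker, ofMvPolynomial_C]; exact hw
    have h2 := Ideal.mem_map_of_mem ψ h1
    rw [hψ, Ideal.map_span] at h2
    have h3 : Ideal.span (ψ '' Set.range x) ≤ RingHom.ker MvPowerSeries.constantCoeff := by
      rw [Ideal.span_le]
      rintro _ ⟨_, ⟨i, rfl⟩, rfl⟩
      simp [hψX]
    simpa using h3 h2
  · intro b
    obtain ⟨b, rfl⟩ := hπ b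
    obtain ⟨p, hp⟩ := h.exists_sub_mem b
    have hp' := h.map_originIdeal_le_span_range hp
    rw [← hker, RingHom.mem_ker, map_sub, sub_eq_zero] at hp'
    refine ⟨MvPolynomial.constantCoeff p, ?_⟩
    rw [hp', ← RingHom.comp_apply, ← RingHom.comp_apply π]
    exact RingHom.congr_fun (MvPolynomial.ringHom_ext (by simp) (by simp [hx])) p

/-- In the last chart every function is a function on the singularity modulo `v`. -/
lemma exists_dvd_sub (h : IsChart k φ x) (hk : k + 1 = n) (b : B) :
    ∃ r, x 1 ∣ b - φ r := by
  have hx : φ (coord W n 0) = x 0 := by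
    rw [h.map_x]
    have h1 : n - k = 1 := by omega
    simp [h1]
  obtain ⟨P, rfl⟩ := h.surjective b
  induction P using MvPolynomial.induction_on with
  | C a => exact ⟨a, by simp⟩
  | add P Q hP hQ =>
    obtain ⟨p, hp⟩ := hP
    obtain ⟨q, hq⟩ := hQ
    refine ⟨p + q, ?_⟩
    rw [map_add, map_add, add_sub_add_comm]
    exact dvd_add hp hq
  | mul_X P i hP =>
    obtain ⟨p, hp⟩ := hP
    rw [map_mul, MvPolynomial.coe_eval₂Hom, MvPolynomial.eval₂_X]
    fin_cases i
    · refine ⟨p * coord W n 0, ?_⟩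
      rw [map_mul, hx]
      change _ ∣ _ * x 0 - _ * x 0
      rw [← sub_mul]
      exact hp.mul_right _
    · exact ⟨0, by simp⟩

/-- A power series in `x`, `y`, `s` that becomes divisible by `v` in the last chart lies in the
ideal generated by `y` and `s`: the coefficient of `x ^ j` becomes that of `u ^ j`. -/
lemma mem_span_of_X_dvd_subst (hn : 0 < n) (hk : k + 1 = n) (F : PS W)
    (h : MvPowerSeries.X 1 ∣ MvPowerSeries.subst (chartMonomial W n k) F) :
    F ∈ Ideal.span ((MvPowerSeries.X : Fin 3 → PS W) '' (({1, 2} : Finset (Fin 3)) : Set _)) := by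
  refine mem_span_X_of_coeff_eq_zero _ _ fun m hm ↦ ?_
  rw [MvPowerSeries.X_dvd_iff] at h
  have h1 := h (.single 0 (m 0)) (by simp)
  rw [MvPowerSeries.coeff_subst (hasSubst_chartMonomial W (by omega)), finsum_eq_single _ m] at h1
  · convert h1 using 1
    rw [Finsupp.prod_fintype _ _ (by simp), Fin.prod_univ_three, hm 1 (by simp), hm 2 (by simp)]
    have h2 : n - k = 1 := by omega
    simp [chartMonomial, h2, MvPowerSeries.coeff_X_pow]
  · intro d hd
    rw [Finsupp.prod_fintype _ _ (by simp), Fin.prod_univ_three]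
    have h2 : n - k = 1 := by omega
    have h3 : chartMonomial W n k 0 ^ d 0 * chartMonomial W n k 1 ^ d 1 *
        chartMonomial W n k 2 ^ d 2 =
        MvPowerSeries.monomial (.single 0 (d 0 + d 1 + k * d 2) + .single 1 (d 1 + n * d 2)) 1 := by
      rw [← mul_one (1 : W), ← MvPowerSeries.monomial_mul_monomial, ← MvPowerSeries.X_pow_eq,
        ← MvPowerSeries.X_pow_eq, ← hk]
      simp only [chartMonomial, Matrix.cons_val]
      simp
      ring
    rw [h3, MvPowerSeries.coeff_monomial, if_neg, smul_zero]
    intro heq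
    apply hd
    have e0 := DFunLike.congr_fun heq 0
    have e1 := DFunLike.congr_fun heq 1
    simp at e0 e1
    have d2 : d 2 = 0 := by
      have : n * d 2 = 0 := by omega
      exact (mul_eq_zero.mp this).resolve_left hn.ne'
    have d1 : d 1 = 0 := by omega
    ext i
    fin_cases i
    · simp [e0, d1, d2]
    · simp [d1, hm 1]
    · simp [d2, hm 2]

/-- `u` is a non-zero-divisor modulo `v`. In `W[[u, v]]` this is clear, and it descends to the chart
because modulo `v` every function is a polynomial in `u` or, in the last chart, where `{v = 0}` does
not lie over the origin, a power series in `x`. -/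
theorem dvd_of_dvd_mul (h : IsChart k φ x) {b : B} (hb : x 1 ∣ x 0 * b) : x 1 ∣ b := by
  obtain ⟨ψ, hψX, hψF, hψ⟩ := h.exists_toPowerSeries'
  -- the claim for power series
  have hX (G : MvPowerSeries (Fin 2) W) (hG : MvPowerSeries.X 1 ∣ MvPowerSeries.X 0 * G) :
      MvPowerSeries.X 1 ∣ G := by
    rw [MvPowerSeries.X_dvd_iff] at hG ⊢
    intro m hm
    have := hG (Finsupp.single 0 1 + m) (by simp [hm])
    rwa [MvPowerSeries.X, MvPowerSeries.coeff_add_monomial_mul, one_mul] at this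
  obtain hk | hk : k + 1 = n ∨ k + 1 < n := by have := h.lt; omega
  · obtain ⟨r, hr⟩ := h.exists_dvd_sub hk b
    obtain ⟨F, rfl⟩ := Ideal.Quotient.mk_surjective r
    have h1 : x 1 ∣ x 0 * φ (Ideal.Quotient.mk _ F) := by
      have : x 0 * φ (Ideal.Quotient.mk _ F) =
        x 0 * b - x 0 * (b - φ (Ideal.Quotient.mk _ F)) := by ring
      rw [this]
      exact dvd_sub hb (hr.mul_left _)
    have h2 := map_dvd ψ h1
    rw [map_mul, hψF, hψX, hψX] at h2
    have h3 := mem_span_of_X_dvd_subst (by omega) hk F (hX _ h2)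
    have h4 : x 1 ∣ φ (Ideal.Quotient.mk _ F) := by
      rw [← Ideal.mem_span_singleton]
      have h5 := Ideal.mem_map_of_mem (φ.comp (Ideal.Quotient.mk (Ideal.span
        {(MvPowerSeries.X 2 * MvPowerSeries.X 0 - MvPowerSeries.X 1 ^ n : PS W)}))) h3
      rw [Ideal.map_span] at h5
      refine Ideal.span_le.mpr ?_ h5
      rintro _ ⟨_, ⟨i, hi, rfl⟩, rfl⟩
      rw [SetLike.mem_coe, Ideal.mem_span_singleton]
      have hi' : i = 1 ∨ i = 2 := by simpa using hi
      rcases hi' with rfl | rfl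
      · exact h.map_y ▸ Dvd.intro_left _ rfl
      · exact h.map_s ▸ (dvd_pow_self _ (by omega)).mul_left _
    rw [← sub_add_cancel b (φ (Ideal.Quotient.mk _ F))]
    exact dvd_add hr h4
  · obtain ⟨p, hp⟩ := h.exists_sub_mem b
    have hp' := h.map_originIdeal_le_span_one hk hp
    rw [Ideal.mem_span_singleton] at hp'
    have h1 : x 1 ∣ x 0 * ofMvPolynomial φ x p := by
      have : x 0 * ofMvPolynomial φ x p = x 0 * b - x 0 * (b - ofMvPolynomial φ x p) := by ring
      rw [this]
      exact dvd_sub hb (hp'.mul_left _)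
    have h2 := map_dvd ψ h1
    rw [map_mul, hψ, hψX, hψX] at h2
    have h3 := hX _ h2
    have h4 : (MvPolynomial.X 1 : MvPolynomial (Fin 2) W) ∣ p := by
      rw [← Ideal.mem_span_singleton]
      have := mem_monomialIdeal_of_coe_mem (W := W) {Finsupp.single (1 : Fin 2) 1} p (by
        rw [monomialIdeal, Set.image_singleton, Ideal.map_span, Set.image_singleton,
          Ideal.mem_span_singleton]
        simpa [← MvPolynomial.X.eq_def] using h3)
      rwa [monomialIdeal, Set.image_singleton] at this
    have h5 := map_dvd (ofMvPolynomial φ x) h4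
    rw [ofMvPolynomial_X] at h5
    rw [← sub_add_cancel b (ofMvPolynomial φ x p)]
    exact dvd_add hp' h5

lemma dvd_of_dvd_pow_mul (h : IsChart k φ x) {b : B} (N : ℕ) (hb : x 1 ∣ x 0 ^ N * b) :
    x 1 ∣ b := by
  induction N with
  | zero => simpa using hb
  | succ N ih =>
    refine ih (h.dvd_of_dvd_mul ?_)
    rwa [← mul_assoc, ← pow_succ']

/-- In the first chart every function becomes a function on the singularity after multiplication
by a power of `s`. -/
theorem exists_pow_mul_eq (h : IsChart 0 φ x) (b : B) :
    ∃ N r, φ (coord W n 2) ^ N * b = φ r := by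
  have hs : φ (coord W n 2) = x 1 := by simp [h.map_s]
  have hy : φ (coord W n 1) = x 0 * φ (coord W n 2) := by rw [h.map_y, hs]
  obtain ⟨P, rfl⟩ := h.surjective b
  induction P using MvPolynomial.induction_on with
  | C a => exact ⟨0, a, by simp⟩
  | add P Q hP hQ =>
    obtain ⟨N, r, hr⟩ := hP
    obtain ⟨M, t, ht⟩ := hQ
    refine ⟨N + M, coord W n 2 ^ M * r + coord W n 2 ^ N * t, ?_⟩
    simp only [map_add, map_mul, map_pow, ← hr, ← ht]
    ring
  | mul_X P i hP =>
    obtain ⟨N, r, hr⟩ := hP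
    rw [map_mul, MvPolynomial.coe_eval₂Hom, MvPolynomial.eval₂_X]
    rw [MvPolynomial.coe_eval₂Hom] at hr
    fin_cases i
    · refine ⟨N + 1, r * coord W n 1, ?_⟩
      rw [map_mul, ← hr, hy]
      simp only [Fin.zero_eta]
      ring
    · refine ⟨N, r * coord W n 2, ?_⟩
      rw [map_mul, ← hr, hs]
      simp only [Fin.mk_one]
      ring

end IsChart

/-! ### Graded rings generated in degrees zero and one -/

lemma isProper_comp_specMap {X : Scheme.{u}} {A B : Type u} [CommRing A] [CommRing B]
    (p : X ⟶ Spec (.of B)) [IsProper p] (φ : A →+* B) (hφ : Function.Surjective φ) :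
    IsProper (p ≫ Spec.map (CommRingCat.ofHom φ)) := by
  have : IsClosedImmersion (Spec.map (CommRingCat.ofHom φ)) :=
    IsClosedImmersion.spec_of_surjective _ hφ
  infer_instance

section Proj

-- The condition on subsemirings below expresses that `𝒜` is generated by the `F i` over `𝒜 0`.
variable {σ S : Type*} [CommRing S] [SetLike σ S] [AddSubgroupClass σ S] (𝒜 : ℕ → σ) [GradedRing 𝒜]
  {ι : Type*} (F : ι → S)

lemma adjoin_eq_top_of_forall_subsemiring
    (h : ∀ T : Subsemiring S, (∀ a ∈ 𝒜 0, a ∈ T) → (∀ i, F i ∈ T) → ∀ p, p ∈ T) :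
    Algebra.adjoin (𝒜 0) (Set.range F) = ⊤ :=
  eq_top_iff.mpr fun p _ ↦ h (Algebra.adjoin (𝒜 0) (Set.range F)).toSubsemiring
    (fun a ha ↦ Subalgebra.algebraMap_mem (Algebra.adjoin (𝒜 0) (Set.range F)) (⟨a, ha⟩ : 𝒜 0))
    (fun i ↦ Algebra.subset_adjoin (Set.mem_range_self i)) p

lemma isProper_toSpecZero [Finite ι]
    (h : ∀ T : Subsemiring S, (∀ a ∈ 𝒜 0, a ∈ T) → (∀ i, F i ∈ T) → ∀ p, p ∈ T) :
    IsProper (Proj.toSpecZero 𝒜) := by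
  have : Algebra.FiniteType (𝒜 0) S := ⟨Subalgebra.fg_def.mpr
    ⟨Set.range F, Set.finite_range F, adjoin_eq_top_of_forall_subsemiring 𝒜 F h⟩⟩
  infer_instance

lemma iSup_basicOpen_eq_top (hF : ∀ i, F i ∈ 𝒜 1)
    (h : ∀ T : Subsemiring S, (∀ a ∈ 𝒜 0, a ∈ T) → (∀ i, F i ∈ T) → ∀ p, p ∈ T) :
    ⨆ i, Proj.basicOpen 𝒜 (F i) = ⊤ :=
  Proj.iSup_basicOpen_eq_top' 𝒜 F (fun i ↦ ⟨1, hF i⟩)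
    (adjoin_eq_top_of_forall_subsemiring 𝒜 F h)

end Proj

/-! ### The Rees algebra as a graded ring -/

section Rees

open Polynomial

variable {A : Type u} [CommRing A] (I : Ideal A)

/-- The homogeneous component `I ^ k X ^ k` of the Rees algebra. -/
def reesGrading (k : ℕ) : Submodule A (reesAlgebra I) where
  carrier := {p | ∀ j, j ≠ k → p.1.coeff j = 0}
  add_mem' hp hq j hj := by simp [hp j hj, hq j hj]
  zero_mem' j hj := by simp
  smul_mem' a p hp j hj := by simp [hp j hj]

variable {I}

/-- The element `a X ^ k` of the Rees algebra, for `a ∈ I ^ k`. -/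
def reesMonomial (k : ℕ) (a : A) (ha : a ∈ I ^ k) : reesAlgebra I :=
  ⟨monomial k a, reesAlgebra.monomial_mem.mpr ha⟩

lemma reesMonomial_mem (k : ℕ) (a : A) (ha : a ∈ I ^ k) :
    reesMonomial k a ha ∈ reesGrading I k := fun j hj ↦ by
  simp [reesMonomial, coeff_monomial, hj.symm]

lemma eq_reesMonomial {k : ℕ} {p : reesAlgebra I} (hp : p ∈ reesGrading I k) :
    p = reesMonomial k (p.1.coeff k) (p.2 k) := by
  ext j
  by_cases hj : j = k
  · subst hj; simp [reesMonomial]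
  · rw [hp j hj]; simp [reesMonomial, coeff_monomial, Ne.symm hj]

instance : SetLike.GradedMonoid (reesGrading I) where
  one_mem j hj := by simp [coeff_one, hj]
  mul_mem i j p q hp hq k hk := by
    rw [eq_reesMonomial hp, eq_reesMonomial hq]
    simp [reesMonomial, monomial_mul_monomial, coeff_monomial, hk.symm]

lemma coeff_coeAddMonoidHom (z : DirectSum ℕ fun k ↦ reesGrading I k) (j : ℕ) :
    (DirectSum.coeAddMonoidHom (reesGrading I) z).1.coeff j = (z j).1.1.coeff j := by
  induction z using DirectSum.induction_on with
  | zero => simp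
  | of i p =>
    rw [DirectSum.coeAddMonoidHom_of]
    by_cases h : i = j
    · subst h; simp
    · rw [p.2 j (Ne.symm h), DirectSum.of_eq_of_ne _ _ _ (Ne.symm h)]
      simp
  | add p q hp hq => simp [hp, hq]

lemma isInternal_reesGrading : DirectSum.IsInternal (reesGrading I) := by
  constructor
  · intro z z' h
    ext j l
    by_cases hl : l = j
    · subst hl
      rw [← coeff_coeAddMonoidHom, ← coeff_coeAddMonoidHom, h]
    · rw [(z j).2 l hl, (z' j).2 l hl]
  · intro p
    refine ⟨∑ k ∈ p.1.support, DirectSum.of (fun k ↦ reesGrading I k) k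
      ⟨reesMonomial k (p.1.coeff k) (p.2 k), reesMonomial_mem _ _ _⟩, ?_⟩
    rw [map_sum]
    simp only [DirectSum.coeAddMonoidHom_of]
    ext1
    rw [AddSubmonoidClass.coe_finsetSum]
    exact p.1.as_sum_support.symm

instance : GradedAlgebra (reesGrading I) where
  toDecomposition := isInternal_reesGrading.chooseDecomposition

lemma algebraMap_zero_surjective :
    Function.Surjective (algebraMap A (reesGrading I 0)) := by
  rintro ⟨p, hp⟩
  refine ⟨p.1.coeff 0, ?_⟩
  exact Subtype.ext (eq_reesMonomial hp).symm

end Rees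

/-! ### Blowing up -/

section Blowup

variable {A : Type u} [CommRing A] {L : Type u} [CommRing L] [Algebra A L] {I : Ideal A}

/-- Evaluation of the Rees algebra at `X = 1`, with values in an `A`-algebra. -/
def reesEval (I : Ideal A) (L : Type u) [CommRing L] [Algebra A L] : reesAlgebra I →+* L :=
  (Polynomial.eval₂RingHom (algebraMap A L) 1).comp (reesAlgebra I).val.toRingHom

lemma reesEval_reesMonomial (k : ℕ) (a : A) (ha : a ∈ I ^ k) :
    reesEval I L (reesMonomial k a ha) = algebraMap A L a := by
  simp [reesEval, reesMonomial]

open HomogeneousLocalization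

/-- The homomorphism to `L` from a degree zero localization of the Rees algebra. -/
def awayEval (F : reesAlgebra I) (hF : IsUnit (reesEval I L F)) : Away (reesGrading I) F →+* L :=
  (IsLocalization.Away.lift (S := Localization.Away F) F hF).comp
    (algebraMap (Away (reesGrading I) F) (Localization.Away F))

lemma awayEval_mk (F : reesAlgebra I) (hF : IsUnit (reesEval I L F)) {d : ℕ}
    (hd : F ∈ reesGrading I d) (m : ℕ) (x : reesAlgebra I) (hx : x ∈ reesGrading I (m • d)) :
    awayEval F hF (Away.mk _ hd m x hx) * reesEval I L F ^ m = reesEval I L x := by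
  have h1 : (Away.mk _ hd m x hx).val * algebraMap (reesAlgebra I) (Localization.Away F) (F ^ m) =
      algebraMap _ _ x := by
    rw [Away.val_mk, Localization.mk_eq_mk', IsLocalization.mk'_spec]
  have h2 := congr(IsLocalization.Away.lift (S := Localization.Away F) F hF $h1)
  rw [map_mul, IsLocalization.Away.lift_eq, IsLocalization.Away.lift_eq, map_pow] at h2
  exact h2

lemma awayEval_injective (hAL : Function.Injective (algebraMap A L)) (F : reesAlgebra I)
    (hF : IsUnit (reesEval I L F)) {d : ℕ} (hd : F ∈ reesGrading I d) :
    Function.Injective (awayEval F hF) := by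
  rw [injective_iff_map_eq_zero]
  intro z hz
  obtain ⟨m, x, hx, rfl⟩ := Away.mk_surjective _ hd z
  have h1 := awayEval_mk F hF hd m x hx
  rw [hz, zero_mul, eq_reesMonomial hx, reesEval_reesMonomial] at h1
  have h2 : x.1.coeff (m • d) = 0 := hAL (by rw [← h1, map_zero])
  have h3 : x = 0 := by
    rw [eq_reesMonomial hx]
    ext
    simp only [reesMonomial, h2]
    simp
  subst h3
  exact mk_eq_zero_of_num _ rfl

lemma awayEval_comp_awayMap (F G : reesAlgebra I) (hF : IsUnit (reesEval I L F)) {e : ℕ}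
    (he : G ∈ reesGrading I e) {H : reesAlgebra I} (hH : H = F * G)
    (hHu : IsUnit (reesEval I L H)) :
    (awayEval H hHu).comp (awayMap (reesGrading I) he hH) = awayEval F hF := by
  ext z
  simp only [awayEval, RingHom.comp_apply, HomogeneousLocalization.algebraMap_apply, val_awayMap]
  rw [← RingHom.comp_apply]
  congr 1
  refine IsLocalization.ringHom_ext (Submonoid.powers F) ?_
  ext p
  simp [Localization.awayLift, IsLocalization.Away.lift_eq]

/-- The homomorphism `Γ(X, U) → L` given by an `L`-valued point of `X` that factors through the
open subscheme `U`. -/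
def evalAt {X : Scheme.{u}} (j : Spec (.of L) ⟶ X) (U : X.Opens) (h : j ⁻¹ᵁ U = ⊤) :
    Γ(X, U) →+* L :=
  (j.appLE U ⊤ h.ge ≫ (Scheme.ΓSpecIso (.of L)).hom).hom

lemma evalAt_map {X : Scheme.{u}} (j : Spec (.of L) ⟶ X) {U V : X.Opens} (h : j ⁻¹ᵁ U = ⊤)
    (h' : j ⁻¹ᵁ V = ⊤) (hVU : V ≤ U) (a : Γ(X, U)) :
    evalAt j V h' (X.presheaf.map (homOfLE hVU).op a) = evalAt j U h a := by
  have := Scheme.Hom.map_appLE j (U := V) (V := ⊤) h'.ge (homOfLE hVU).op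
  simp only [evalAt, ← this, CommRingCat.hom_comp, RingHom.comp_apply]

/-- If `e` identifies the spectrum of `B` with the open subscheme `U`, evaluation of functions on `U` at an
`L`-valued point becomes the given homomorphism `t : B → L`. -/
lemma exists_bijective_evalAt {X : Scheme.{u}} {B : Type u} [CommRing B]
    (e : Spec (.of B) ⟶ X) [IsOpenImmersion e] (t : B →+* L) (j : Spec (.of L) ⟶ X)
    (hj : j = Spec.map (CommRingCat.ofHom t) ≫ e) (U : X.Opens) (hU : e.opensRange = U) :
    ∃ (h : j ⁻¹ᵁ U = ⊤) (κ : Γ(X, U) →+* B), Function.Bijective κ ∧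
      (∀ a, evalAt j U h a = t (κ a)) ∧
      ∀ (a : Γ(X, U)) (V : X.Opens), e ⁻¹ᵁ V = PrimeSpectrum.basicOpen (κ a) →
        U ⊓ V = X.basicOpen a := by
  subst hj hU
  have h : e ⁻¹ᵁ e.opensRange = ⊤ := Scheme.Hom.preimage_opensRange e
  refine ⟨by simp, (e.appLE e.opensRange ⊤ h.ge ≫ (Scheme.ΓSpecIso (.of B)).hom).hom, ?_, ?_, ?_⟩
  · have := Scheme.Hom.isIso_app e e.opensRange le_rfl
    have : IsIso (e.appLE e.opensRange ⊤ h.ge) := by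
      rw [Scheme.Hom.appLE]
      have : IsIso (homOfLE h.ge) := ⟨homOfLE h.le, Subsingleton.elim _ _, Subsingleton.elim _ _⟩
      infer_instance
    exact ConcreteCategory.bijective_of_isIso _
  · intro a
    simp only [evalAt]
    rw [← Scheme.Hom.appLE_comp_appLE _ _ _ ⊤ _ h.ge (by simp)]
    rw [Category.assoc]
    have : (Spec.map (CommRingCat.ofHom t)).appLE ⊤ ⊤ (by simp) ≫
        (Scheme.ΓSpecIso (.of L)).hom = (Scheme.ΓSpecIso (.of B)).hom ≫ CommRingCat.ofHom t := by
      rw [← Scheme.ΓSpecIso_naturality]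
      congr 1
    rw [this]
    simp
  · intro a V hV
    have h1 := Scheme.basicOpen_appLE e ⊤ e.opensRange h.ge a
    rw [top_inf_eq, basicOpen_eq_of_affine'] at h1
    have h2 : e ⁻¹ᵁ V = e ⁻¹ᵁ X.basicOpen a := hV.trans h1
    rw [← Scheme.Hom.image_preimage_eq_opensRange_inf, h2,
      Scheme.Hom.image_preimage_eq_opensRange_inf,
      inf_eq_right.mpr (X.basicOpen_le a)]

lemma reesMonomial_mul (k l : ℕ) (a b : A) (ha : a ∈ I ^ k) (hb : b ∈ I ^ l) :
    reesMonomial (k + l) (a * b) (pow_add I k l ▸ Ideal.mul_mem_mul ha hb) =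
      reesMonomial k a ha * reesMonomial l b hb :=
  Subtype.ext (Polynomial.monomial_mul_monomial k l a b).symm

lemma reesMonomial_smul (k : ℕ) (a b : A) (hb : b ∈ I ^ k) :
    reesMonomial k (a • b) (Ideal.mul_mem_left _ a hb) =
      reesMonomial 0 a (by simp) * reesMonomial k b hb := by
  refine Subtype.ext ?_
  simp [reesMonomial]

lemma reesMonomial_add (k : ℕ) (a b : A) (ha : a ∈ I ^ k) (hb : b ∈ I ^ k) :
    reesMonomial k (a + b) (add_mem ha hb) = reesMonomial k a ha + reesMonomial k b hb :=
  Subtype.ext (map_add (Polynomial.monomial k) a b)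

lemma reesMonomial_one_mem {ι : Type*} (f : ι → A) (hI : I = Ideal.span (Set.range f))
    (hf : ∀ i, f i ∈ I ^ 1) (T : Subsemiring (reesAlgebra I))
    (h0 : ∀ a ha, reesMonomial 0 a ha ∈ T) (hfT : ∀ i, reesMonomial 1 (f i) (hf i) ∈ T)
    (c : A) (hc : c ∈ Ideal.span (Set.range f)) : ∀ h, reesMonomial (I := I) 1 c h ∈ T := by
  induction hc using Submodule.span_induction with
  | mem c hc =>
    obtain ⟨i, rfl⟩ := hc
    exact fun _ ↦ hfT i
  | zero =>
    intro h
    have : reesMonomial (I := I) 1 0 h = 0 := Subtype.ext (map_zero _)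
    rw [this]
    exact T.zero_mem
  | add c d hc hd ihc ihd =>
    intro h
    have hc' : c ∈ I ^ 1 := by rw [pow_one, hI]; exact hc
    have hd' : d ∈ I ^ 1 := by rw [pow_one, hI]; exact hd
    rw [reesMonomial_add 1 c d hc' hd']
    exact add_mem (ihc _) (ihd _)
  | smul r c hc ihc =>
    intro h
    have hc' : c ∈ I ^ 1 := by rw [pow_one, hI]; exact hc
    rw [reesMonomial_smul 1 r c hc']
    exact mul_mem (h0 r (by simp)) (ihc hc')

lemma reesMonomial_mem_of_one (T : Subsemiring (reesAlgebra I))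
    (h0 : ∀ a ha, reesMonomial 0 a ha ∈ T)
    (h1 : ∀ (c : A) (hc : c ∈ I ^ 1), reesMonomial 1 c hc ∈ T)
    (k : ℕ) (a : A) (ha : a ∈ I ^ k) : reesMonomial k a ha ∈ T := by
  induction k generalizing a with
  | zero => exact h0 a ha
  | succ k ih =>
    have ha' : a ∈ I ^ k • I ^ 1 := by rwa [smul_eq_mul, ← pow_add]
    suffices ∃ h, reesMonomial (I := I) (k + 1) a h ∈ T from this.2
    refine Submodule.smul_induction_on ha' (fun b hb c hc ↦ ?_) fun b c hb hc ↦ ?_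
    · refine ⟨(pow_add I k 1 ▸ Ideal.mul_mem_mul hb hc : b * c ∈ I ^ (k + 1)), ?_⟩
      change reesMonomial (k + 1) (b * c) _ ∈ T
      rw [reesMonomial_mul k 1 b c hb hc]
      exact mul_mem (ih b hb) (h1 c hc)
    · obtain ⟨hb, hb'⟩ := hb
      obtain ⟨hc, hc'⟩ := hc
      refine ⟨add_mem hb hc, ?_⟩
      rw [reesMonomial_add _ b c hb hc]
      exact add_mem hb' hc'

lemma eq_sum_reesMonomial (p : reesAlgebra I) :
    p = ∑ k ∈ p.1.support, reesMonomial k (p.1.coeff k) (p.2 k) := by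
  refine Subtype.ext ?_
  rw [AddSubmonoidClass.coe_finsetSum]
  exact p.1.as_sum_support

/-- The Rees algebra is generated in degrees zero and one. -/
lemma mem_of_reesMonomial_mem {ι : Type*} (f : ι → A) (hI : I = Ideal.span (Set.range f))
    (hf : ∀ i, f i ∈ I ^ 1) (T : Subsemiring (reesAlgebra I))
    (h0 : ∀ a ha, reesMonomial 0 a ha ∈ T) (hfT : ∀ i, reesMonomial 1 (f i) (hf i) ∈ T)
    (p : reesAlgebra I) : p ∈ T := by
  rw [eq_sum_reesMonomial p]
  refine sum_mem fun k _ ↦ reesMonomial_mem_of_one T h0 (fun c hc ↦ ?_) _ _ _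
  exact reesMonomial_one_mem f hI hf T h0 hfT c (by rwa [pow_one, hI] at hc) hc

/-- The `L`-valued points of the standard charts all give the same `L`-valued point of the
blowing up. -/
lemma specMap_awayEval_awayι (F G : reesAlgebra I) (hFu : IsUnit (reesEval I L F))
    (hGu : IsUnit (reesEval I L G)) (hF : F ∈ reesGrading I 1) (hG : G ∈ reesGrading I 1) :
    Spec.map (CommRingCat.ofHom (awayEval F hFu)) ≫ Proj.awayι (reesGrading I) F hF one_pos =
      Spec.map (CommRingCat.ofHom (awayEval G hGu)) ≫
        Proj.awayι (reesGrading I) G hG one_pos := by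
  have hu : IsUnit (reesEval I L (F * G)) := by rw [map_mul]; exact hFu.mul hGu
  rw [← awayEval_comp_awayMap F G hFu hG rfl hu,
    ← awayEval_comp_awayMap G F hGu hF (mul_comm _ _) hu,
    CommRingCat.ofHom_comp, CommRingCat.ofHom_comp, Spec.map_comp, Spec.map_comp,
    Category.assoc, Category.assoc, Proj.SpecMap_awayMap_awayι, Proj.SpecMap_awayMap_awayι]

/-- The standard charts of the blowing up. -/
lemma exists_chart_proj (hAL : Function.Injective (algebraMap A L)) (F : reesAlgebra I)
    (hFu : IsUnit (reesEval I L F)) (hF : F ∈ reesGrading I 1)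
    (j : Spec (.of L) ⟶ Proj (reesGrading I))
    (hj : j = Spec.map (CommRingCat.ofHom (awayEval F hFu)) ≫
      Proj.awayι (reesGrading I) F hF one_pos) :
    ∃ h : j ⁻¹ᵁ Proj.basicOpen (reesGrading I) F = ⊤,
      Function.Injective (evalAt j (Proj.basicOpen (reesGrading I) F) h) ∧
      (∀ G ∈ reesGrading I 1, ∃ g, evalAt j (Proj.basicOpen (reesGrading I) F) h g *
          reesEval I L F = reesEval I L G ∧
        Proj.basicOpen (reesGrading I) F ⊓ Proj.basicOpen (reesGrading I) G =
          (Proj (reesGrading I)).basicOpen g) ∧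
      ∀ b, ∃ m, ∃ a ∈ I ^ m, evalAt j (Proj.basicOpen (reesGrading I) F) h b *
        reesEval I L F ^ m = algebraMap A L a := by
  obtain ⟨h, κ, hκ, hκt, hκb⟩ := exists_bijective_evalAt _ (awayEval F hFu) j hj
    (Proj.basicOpen (reesGrading I) F) (Proj.opensRange_awayι _ _ hF one_pos)
  refine ⟨h, ?_, fun G hG ↦ ?_, fun b ↦ ?_⟩
  · intro a b hab
    rw [hκt, hκt] at hab
    exact hκ.1 (awayEval_injective hAL _ _ hF hab)
  · obtain ⟨g, hg⟩ := hκ.2 (Away.isLocalizationElem hF hG)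
    refine ⟨g, ?_, ?_⟩
    · rw [hκt, hg]
      have := awayEval_mk (L := L) F hFu hF 1 (G ^ 1) (SetLike.pow_mem_graded 1 hG)
      rw [pow_one (reesEval I L F), map_pow, pow_one (reesEval I L G)] at this
      exact this
    · refine hκb g _ ?_
      rw [hg]
      exact Proj.awayι_preimage_basicOpen (reesGrading I) hF one_pos hG one_pos
  · obtain ⟨m, x, hx, hb⟩ := Away.mk_surjective (reesGrading I) hF (κ b)
    refine ⟨m, x.1.coeff m, x.2 m, ?_⟩
    rw [hκt, ← hb, awayEval_mk]
    have hx' : x ∈ reesGrading I m := by simpa using hx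
    conv_lhs => rw [eq_reesMonomial hx']
    exact reesEval_reesMonomial _ _ _

lemma awayEval_fromZeroRingHom (F : reesAlgebra I) (hF : IsUnit (reesEval I L F)) (a : A) :
    awayEval F hF (fromZeroRingHom (reesGrading I) (.powers F)
      (algebraMap A (reesGrading I 0) a)) = algebraMap A L a := by
  have h1 : (fromZeroRingHom (reesGrading I) (.powers F) (algebraMap A (reesGrading I 0) a)).val =
      algebraMap (reesAlgebra I) (Localization.Away F) (algebraMap A (reesAlgebra I) a) := by
    rw [← Localization.mk_one_eq_algebraMap]
    rfl
  rw [awayEval, RingHom.comp_apply, HomogeneousLocalization.algebraMap_apply, h1,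
    IsLocalization.Away.lift_eq]
  simp [reesEval]

/-- The morphism from the blowing up to `Spec A`. -/
def projToSpec (I : Ideal A) : Proj (reesGrading I) ⟶ Spec (.of A) :=
  Proj.toSpecZero (reesGrading I) ≫
    Spec.map (CommRingCat.ofHom (algebraMap A (reesGrading I 0)))

lemma specMap_awayEval_awayι_projToSpec (F : reesAlgebra I) (hFu : IsUnit (reesEval I L F))
    (hF : F ∈ reesGrading I 1) :
    (Spec.map (CommRingCat.ofHom (awayEval F hFu)) ≫
      Proj.awayι (reesGrading I) F hF one_pos) ≫ projToSpec I =
      Spec.map (CommRingCat.ofHom (algebraMap A L)) := by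
  rw [projToSpec, Category.assoc, Proj.awayι_toSpecZero_assoc, ← Spec.map_comp, ← Spec.map_comp,
    ← CommRingCat.ofHom_comp, ← CommRingCat.ofHom_comp]
  congr 2
  ext a
  exact awayEval_fromZeroRingHom F hFu a

lemma isProper_projToSpec {ι : Type*} [Finite ι] (F : ι → reesAlgebra I)
    (h : ∀ T : Subsemiring (reesAlgebra I), (∀ a ∈ reesGrading I 0, a ∈ T) → (∀ i, F i ∈ T) →
      ∀ p, p ∈ T) : IsProper (projToSpec I) := by
  have h1 : IsProper (Proj.toSpecZero (reesGrading I)) := by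
    refine isProper_toSpecZero (reesGrading I) F fun T h0 hT p ↦ ?_
    exact h T h0 hT p
  unfold projToSpec
  exact isProper_comp_specMap (Proj.toSpecZero (reesGrading I)) (algebraMap A (reesGrading I 0))
    algebraMap_zero_surjective

/-- The blowing up of `Spec A` in the ideal generated by elements `f i` that become invertible in
an `A`-algebra `L` containing `A`: it has an `L`-valued point through which all coordinate rings
of the standard charts are subrings `A[f k / f i]` of `L`. -/
theorem exists_blowup (hAL : Function.Injective (algebraMap A L)) {ι : Type*} [Finite ι]
    [Nonempty ι] (f : ι → A) (hf : ∀ i, IsUnit (algebraMap A L (f i))) :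
    ∃ (X : Scheme.{u}) (ρ : X ⟶ Spec (.of A)) (j : Spec (.of L) ⟶ X) (U : ι → X.affineOpens)
      (hU : ∀ i, j ⁻¹ᵁ (U i).1 = ⊤), IsProper ρ ∧
      j ≫ ρ = Spec.map (CommRingCat.ofHom (algebraMap A L)) ∧ ⨆ i, (U i).1 = ⊤ ∧
      ∀ i, Function.Injective (evalAt j (U i).1 (hU i)) ∧
        (∀ k, ∃ g, evalAt j (U i).1 (hU i) g * algebraMap A L (f i) = algebraMap A L (f k) ∧
          (U i).1 ⊓ (U k).1 = X.basicOpen g) ∧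
        ∀ b, ∃ m, ∃ a ∈ Ideal.span (Set.range f) ^ m,
          evalAt j (U i).1 (hU i) b * algebraMap A L (f i) ^ m = algebraMap A L a := by
  obtain ⟨I, hI⟩ : ∃ I, I = Ideal.span (Set.range f) := ⟨_, rfl⟩
  have hfI (i) : f i ∈ I ^ 1 := by rw [pow_one, hI]; exact Ideal.subset_span ⟨i, rfl⟩
  obtain ⟨F, hF, hFL, hFt⟩ : ∃ F : ι → reesAlgebra I, (∀ i, F i ∈ reesGrading I 1) ∧
      (∀ i, reesEval I L (F i) = algebraMap A L (f i)) ∧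
      ∀ T : Subsemiring (reesAlgebra I), (∀ a ∈ reesGrading I 0, a ∈ T) → (∀ i, F i ∈ T) →
        ∀ p, p ∈ T :=
    ⟨fun i ↦ reesMonomial 1 (f i) (hfI i), fun i ↦ reesMonomial_mem _ _ _,
      fun i ↦ reesEval_reesMonomial _ _ _, fun T h0 ↦ mem_of_reesMonomial_mem f hI hfI T
        fun a ha ↦ h0 _ (reesMonomial_mem 0 a ha)⟩
  have hFu (i) : IsUnit (reesEval I L (F i)) := by rw [hFL]; exact hf i
  obtain ⟨i₀⟩ := ‹Nonempty ι›
  obtain ⟨j, hj⟩ : ∃ j : Spec (.of L) ⟶ Proj (reesGrading I), ∀ i,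
      j = Spec.map (CommRingCat.ofHom (awayEval (F i) (hFu i))) ≫
        Proj.awayι (reesGrading I) (F i) (hF i) one_pos :=
    ⟨_, fun i ↦ specMap_awayEval_awayι (F i₀) (F i) (hFu i₀) (hFu i) (hF i₀) (hF i)⟩
  choose hU hinj hov hrange using
    fun i ↦ exists_chart_proj hAL (F i) (hFu i) (hF i) j (hj i)
  rw [← hI]
  refine ⟨Proj (reesGrading I), projToSpec I, j,
    fun i ↦ ⟨Proj.basicOpen (reesGrading I) (F i), Proj.isAffineOpen_basicOpen _ _ (hF i) one_pos⟩,
    hU, isProper_projToSpec F hFt, ?_, iSup_basicOpen_eq_top _ F hF hFt,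
    fun i ↦ ⟨hinj i, fun k ↦ ?_, fun b ↦ ?_⟩⟩
  · rw [hj i₀]
    exact specMap_awayEval_awayι_projToSpec _ _ _
  · obtain ⟨g, hg, hg'⟩ := hov i (F k) (hF k)
    exact ⟨g, by rwa [hFL, hFL] at hg, hg'⟩
  · obtain ⟨m, a, ha, hb⟩ := hrange i b
    exact ⟨m, a, ha, by rwa [hFL] at hb⟩

end Blowup

/-! ### The charts of the blowing up -/

section Monomials

variable {B L : Type*} [CommRing B] [CommRing L] {θ : B →+* L} {y s u v : B} {f : ℕ → L} {n k : ℕ}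

/-- The quotients `f i / f k` with `k < i` are multiples of `u`. -/
lemma exists_mul_of_lt (hs : IsUnit (θ s))
    (hf : ∀ i, i + 1 < n → f (i + 1) * θ s = f i * θ y ^ (i + 1))
    (hu : θ u * θ s = θ y ^ (k + 1)) {T : Subsemiring B} (hyT : y ∈ T) (huT : u ∈ T)
    {i : ℕ} (hki : k < i) (hi : i < n) : ∃ c ∈ T, θ (u * c) * f k = f i := by
  induction i, hki using Nat.le_induction with
  | base =>
    refine ⟨1, T.one_mem, hs.mul_right_cancel ?_⟩
    rw [hf k hi, ← hu, mul_one]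
    ring
  | succ i hki ih =>
    obtain ⟨c, hc, h⟩ := ih (by omega)
    refine ⟨c * u * y ^ (i - k), mul_mem (mul_mem hc huT) (pow_mem hyT _), hs.mul_right_cancel ?_⟩
    have e : i + 1 = (i - k) + (k + 1) := by omega
    have h1 : θ y ^ (i + 1) = θ y ^ (i - k) * (θ u * θ s) := by
      rw [hu, ← pow_add, ← e]
    rw [hf i hi, h1, ← h]
    simp only [map_mul, map_pow]
    ring

/-- The quotients `f i / f k` with `i < k` are multiples of `v`, and even of `u v` unless `i` is
`k - 1`. -/
lemma exists_mul_of_gt (hy : IsUnit (θ y))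
    (hf : ∀ i, i + 1 < n → f (i + 1) * θ s = f i * θ y ^ (i + 1))
    (hv : θ v * θ y ^ k = θ s) (huv : y = u * v) {T : Subsemiring B} (hyT : y ∈ T) (hvT : v ∈ T)
    {i : ℕ} (hki : i < k) (hk : k < n) :
    ∃ c ∈ T, θ (v * c) * f k = f i ∧ (i + 1 < k → u ∣ c) := by
  obtain ⟨d, rfl⟩ : ∃ d, k = i + d + 1 := ⟨k - i - 1, by omega⟩
  induction d generalizing i with
  | zero =>
    refine ⟨1, T.one_mem, (hy.pow (i + 1)).mul_right_cancel ?_, by omega⟩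
    rw [← hf i (by simpa using hk), ← hv, mul_one]
    simp only [add_zero]
    ring
  | succ d ih =>
    have e : i + (d + 1) + 1 = i + 1 + d + 1 := by ring
    rw [e] at hv hk
    obtain ⟨c, hc, h, -⟩ := ih hv (by omega) hk
    refine ⟨c * v * y ^ (d + 1), mul_mem (mul_mem hc hvT) (pow_mem hyT _),
      (hy.pow (i + 1)).mul_right_cancel ?_, fun _ ↦ ?_⟩
    · rw [← hf i (by omega), ← hv, ← h, e]
      simp only [map_mul, map_pow]
      ring
    · exact ((huv ▸ Dvd.intro _ rfl : u ∣ y).trans (dvd_pow_self _ d.succ_ne_zero)).mul_left _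

/-- If a subring over `A` contains all `f i / c`, it contains all `a / c ^ m` with
`a ∈ (f i) ^ m`. -/
lemma exists_mul_pow_eq_of_mem_span_pow {A : Type*} [CommRing A] [Algebra A L] (φ : A →+* B)
    (hφ : θ.comp φ = algebraMap A L) {T : Subsemiring B} (hT : ∀ a, φ a ∈ T) {ι : Type*} (f : ι → A)
    (c : L) (hf : ∀ i, ∃ t ∈ T, θ t * c = algebraMap A L (f i)) (m : ℕ) (a : A)
    (ha : a ∈ Ideal.span (Set.range f) ^ m) : ∃ t ∈ T, θ t * c ^ m = algebraMap A L a := by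
  have hφ' (a : A) : θ (φ a) = algebraMap A L a := RingHom.congr_fun hφ a
  induction m generalizing a with
  | zero => exact ⟨φ a, hT a, by simp [hφ']⟩
  | succ m ih =>
    rw [pow_succ', ← smul_eq_mul] at ha
    refine Submodule.smul_induction_on ha (fun b hb d hd ↦ ?_) fun b d hb hd ↦ ?_
    · obtain ⟨t, ht, h⟩ := ih d hd
      have hb' : ∃ t ∈ T, θ t * c = algebraMap A L b := by
        induction hb using Submodule.span_induction with
        | mem b hb => obtain ⟨i, rfl⟩ := hb; exact hf i
        | zero => exact ⟨0, T.zero_mem, by simp⟩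
        | add b b' _ _ h h' =>
          obtain ⟨t, ht, h⟩ := h
          obtain ⟨t', ht', h'⟩ := h'
          exact ⟨t + t', add_mem ht ht', by rw [map_add, add_mul, h, h', map_add]⟩
        | smul r b _ h =>
          obtain ⟨t, ht, h⟩ := h
          exact ⟨φ r * t, mul_mem (hT r) ht, by
            rw [map_mul, mul_assoc, h, hφ', smul_eq_mul, map_mul]⟩
      obtain ⟨t', ht', h'⟩ := hb'
      refine ⟨t' * t, mul_mem ht' ht, ?_⟩
      rw [smul_eq_mul, map_mul, map_mul, ← h, ← h']
      ring
    · obtain ⟨t, ht, h⟩ := hb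
      obtain ⟨t', ht', h'⟩ := hd
      exact ⟨t + t', add_mem ht ht', by rw [map_add, add_mul, h, h', map_add]⟩

end Monomials

section Eval

variable {A : Type u} [CommRing A] {L : Type u} [CommRing L] {X : Scheme.{u}}

/-- The homomorphism `A → Γ(X, U)` of a scheme `X` over `Spec A`. -/
def specHom (ρ : X ⟶ Spec (.of A)) (U : X.Opens) : A →+* Γ(X, U) :=
  ((Scheme.ΓSpecIso (.of A)).inv ≫ ρ.appLE ⊤ U le_top).hom

lemma evalAt_comp_specHom [Algebra A L] (ρ : X ⟶ Spec (.of A)) (j : Spec (.of L) ⟶ X)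
    (hj : j ≫ ρ = Spec.map (CommRingCat.ofHom (algebraMap A L))) (U : X.Opens)
    (h : j ⁻¹ᵁ U = ⊤) : (evalAt j U h).comp (specHom ρ U) = algebraMap A L := by
  rw [evalAt, specHom, ← CommRingCat.hom_comp]
  have h1 := Scheme.Hom.appLE_comp_appLE j ρ ⊤ U ⊤ le_top h.ge
  rw [Category.assoc, reassoc_of% h1]
  simp only [hj]
  have h2 : (Spec.map (CommRingCat.ofHom (algebraMap A L))).appLE ⊤ ⊤ (by simp) ≫
      (Scheme.ΓSpecIso (.of L)).hom =
      (Scheme.ΓSpecIso (.of A)).hom ≫ CommRingCat.ofHom (algebraMap A L) := by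
    rw [← Scheme.ΓSpecIso_naturality]
    congr 1
  rw [h2]
  simp

lemma specHom_map (ρ : X ⟶ Spec (.of A)) {U V : X.Opens} (h : V ≤ U) (a : A) :
    X.presheaf.map (homOfLE h).op (specHom ρ U a) = specHom ρ V a := by
  have h1 := Scheme.Hom.appLE_map ρ (U := ⊤) (V := U) le_top (homOfLE h).op
  exact congr(CommRingCat.Hom.hom $h1 ((Scheme.ΓSpecIso (.of A)).inv a))

lemma exists_pow_mul_eq_map {U : X.Opens} (hU : IsAffineOpen U) (g : Γ(X, U))
    (a : Γ(X, X.basicOpen g)) : ∃ (N : ℕ) (b : Γ(X, U)),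
      X.presheaf.map (homOfLE (X.basicOpen_le g)).op b =
        X.presheaf.map (homOfLE (X.basicOpen_le g)).op g ^ N * a := by
  have := hU.isLocalization_basicOpen g
  obtain ⟨⟨b, ⟨_, N, rfl⟩⟩, h⟩ := IsLocalization.surj (Submonoid.powers g) a
  refine ⟨N, b, ?_⟩
  rw [← map_pow, mul_comm]
  exact h.symm

/-- Functions on a principal open subset are determined by their values at an `L`-valued point
if this holds for functions on the whole open subset. -/
lemma evalAt_injective_of_eq_basicOpen (j : Spec (.of L) ⟶ X) {U V : X.Opens} (hU : IsAffineOpen U)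
    (h : j ⁻¹ᵁ U = ⊤) (hinj : Function.Injective (evalAt j U h)) (g : Γ(X, U))
    (hV : V = X.basicOpen g) (h' : j ⁻¹ᵁ V = ⊤) : Function.Injective (evalAt j V h') := by
  subst hV
  rw [injective_iff_map_eq_zero]
  intro a ha
  have hg : IsUnit (X.presheaf.map (homOfLE (X.basicOpen_le g)).op g) :=
    RingedSpace.isUnit_res_basicOpen _ g
  obtain ⟨N, b, hb⟩ := exists_pow_mul_eq_map hU g a
  have h1 := congr(evalAt j _ h' $hb)
  rw [evalAt_map j h h', map_mul, ha, mul_zero] at h1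
  rw [hinj (h1.trans (map_zero _).symm), map_zero] at hb
  exact (hg.pow N).mul_right_eq_zero.mp hb.symm

end Eval

section Charts

variable {W : Type u} [CommRing W] {n : ℕ}

/-- The affine open subsets `U k` cover `X'`, and they are the charts of the resolution `ρ`, with
coordinates `u = x k 0` and `v = x k 1`. The intersection `U i ∩ U k` is a principal open subset
`D(g)` of `U i`; it lies in the complement of `{u = 0}` if `k > i` or `k < i - 1`, and it contains the
locus where `s` is invertible if `k = 0`. The intersection with the next chart is `D(u)`, and there
the coordinate `u` of the next chart is `u ^ 2 v`. -/
structure AreCharts {X' : Scheme.{u}} (ρ : X' ⟶ X W n) (U : Fin n → X'.affineOpens)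
    (x : ∀ k, Fin 2 → Γ(X', (U k).1)) : Prop where
  isProper : IsProper ρ
  iSup_eq_top : ⨆ k, (U k).1 = ⊤
  isChart (k : Fin n) : IsChart k (specHom ρ (U k).1) (x k)
  injective (k : Fin n) : Function.Injective (specHom ρ (U k).1)
  exists_inf_eq (i k : Fin n) : ∃ g, (U i).1 ⊓ (U k).1 = X'.basicOpen g ∧
    (i < k → x i 0 ∣ g) ∧ (k.1 + 1 < i → x i 0 ∣ g) ∧
    (k.1 = 0 → ∃ N, g ∣ specHom ρ (U i).1 (coord W n 2) ^ N)
  inf_succ (i k : Fin n) (h : k.1 = i + 1) : (U i).1 ⊓ (U k).1 = X'.basicOpen (x i 0)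
  map_succ (i k : Fin n) (h : k.1 = i + 1) :
    X'.presheaf.map (homOfLE (inf_le_right : (U i).1 ⊓ (U k).1 ≤ (U k).1)).op (x k 0) =
      X'.presheaf.map (homOfLE (inf_le_left : (U i).1 ⊓ (U k).1 ≤ (U i).1)).op
        (x i 0 ^ 2 * x i 1)

/-- The generators `f k = s ^ (n - 1 - k) y ^ (1 + ⋯ + k)` of the ideal that is blown up. The
exponents are chosen such that `f (k + 1) / f k = y ^ (k + 1) / s`. -/
def blowupGenerator (W : Type u) [CommRing W] (n k : ℕ) : R W n :=
  coord W n 2 ^ (n - 1 - k) * ∏ j ∈ Finset.range k, coord W n 1 ^ (j + 1)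

lemma blowupGenerator_succ_mul {k : ℕ} (hk : k + 1 < n) :
    blowupGenerator W n (k + 1) * coord W n 2 =
      blowupGenerator W n k * coord W n 1 ^ (k + 1) := by
  have e : n - 1 - k = n - 1 - (k + 1) + 1 := by omega
  rw [blowupGenerator, blowupGenerator, Finset.prod_range_succ, e, pow_succ]
  ring

/-- The resolution is the blowing up of the ideal generated by the `blowupGenerator`s. -/
theorem exists_areCharts (W : Type u) [CommRing W] {n : ℕ} (hn : 0 < n) :
    ∃ (X' : Scheme.{u}) (ρ : X' ⟶ X W n) (U : Fin n → X'.affineOpens)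
      (x : ∀ k, Fin 2 → Γ(X', (U k).1)), AreCharts ρ U x := by
  let L := Localization.Away (coord W n 1)
  have hAL : Function.Injective (algebraMap (R W n) L) :=
    IsLocalization.injective _ (Submonoid.powers_le.mpr (coord_one_mem_nonZeroDivisors hn))
  have hY : IsUnit (algebraMap (R W n) L (coord W n 1)) :=
    IsLocalization.Away.algebraMap_isUnit (coord W n 1)
  have hS : IsUnit (algebraMap (R W n) L (coord W n 2)) := by
    refine isUnit_of_mul_isUnit_left (y := algebraMap (R W n) L (coord W n 0)) ?_
    rw [← map_mul, coord_relation, map_pow]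
    exact hY.pow n
  have hf (k : ℕ) : IsUnit (algebraMap (R W n) L (blowupGenerator W n k)) := by
    rw [blowupGenerator, map_mul, map_pow, map_prod]
    refine (hS.pow _).mul ?_
    rw [IsUnit.prod_iff]
    intro j _
    rw [map_pow]
    exact hY.pow _
  have hrel (i : ℕ) (hi : i + 1 < n) := congr(algebraMap (R W n) L
    $(blowupGenerator_succ_mul (W := W) hi))
  simp only [map_mul, map_pow] at hrel
  have : Nonempty (Fin n) := ⟨⟨0, hn⟩⟩
  obtain ⟨X', ρ, j, U, hU, hρ, hj, htop, H⟩ :=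
    exists_blowup hAL (fun k : Fin n ↦ blowupGenerator W n k) (fun k ↦ hf k)
  have hinj (i) := (H i).1
  have hinf (i) := (H i).2.1
  have hrange (i) := (H i).2.2
  choose g hg hgU using hinf
  have hφ (k) := evalAt_comp_specHom ρ j hj (U k).1 (hU k)
  have hφ' (k) (a) : evalAt j (U k).1 (hU k) (specHom ρ (U k).1 a) = algebraMap _ L a :=
    RingHom.congr_fun (hφ k) a
  have hu (k : Fin n) : ∃ u, evalAt j (U k).1 (hU k) u * algebraMap _ L (coord W n 2) =
      algebraMap _ L (coord W n 1) ^ (k.1 + 1) ∧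
      ∀ i : Fin n, i.1 = k + 1 → (U k).1 ⊓ (U i).1 = X'.basicOpen u := by
    by_cases hk : k.1 + 1 < n
    · refine ⟨g k ⟨k + 1, hk⟩, ?_, ?_⟩
      · refine (hf k).mul_left_cancel ?_
        rw [← hrel k hk, ← hg k ⟨k + 1, hk⟩]
        ring
      · intro i hi
        obtain rfl : i = ⟨k + 1, hk⟩ := Fin.ext hi
        exact hgU _ _
    · -- in the last chart, `y ^ n / s` is the function `x`
      refine ⟨specHom ρ (U k).1 (coord W n 0), ?_, fun i hi ↦ by omega⟩
      have e : k.1 + 1 = n := by omega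
      rw [hφ', mul_comm, ← map_mul, coord_relation, map_pow, e]
  have hv (k : Fin n) : ∃ v, evalAt j (U k).1 (hU k) v *
      algebraMap _ L (coord W n 1) ^ k.1 = algebraMap _ L (coord W n 2) := by
    obtain ⟨_ | k, hk⟩ := k
    · -- in the first chart, `v` is the function `s`
      exact ⟨specHom ρ _ (coord W n 2), by rw [hφ', pow_zero, mul_one]⟩
    · refine ⟨g ⟨k + 1, hk⟩ ⟨k, by omega⟩, ?_⟩
      refine (hf (k + 1)).mul_left_cancel ?_
      rw [hrel k hk, ← hg ⟨k + 1, hk⟩ ⟨k, by omega⟩]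
      ring
  choose u hu huU using hu
  choose v hv using hv
  have huv (k) : specHom ρ (U k).1 (coord W n 1) = u k * v k := by
    apply hinj k
    refine (hY.pow k.1).mul_right_cancel ?_
    rw [hφ', map_mul, mul_assoc, hv, hu, pow_succ']
  -- all quotients of the generators are polynomials in `u`, `v` and `y`
  have hup (k i : Fin n) (hki : k < i) (T : Subsemiring Γ(X', (U k).1))
      (h1 : specHom ρ (U k).1 (coord W n 1) ∈ T) (h2 : u k ∈ T) := by
    have := exists_mul_of_lt (θ := evalAt j (U k).1 (hU k)) (T := T) (i := i)
      (s := specHom ρ (U k).1 (coord W n 2)) (f := fun i ↦ algebraMap _ L (blowupGenerator W n i))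
      (by rw [hφ']; exact hS) (by rw [hφ', hφ']; exact hrel) (by rw [hφ', hφ']; exact hu k) h1 h2
      hki i.2
    exact this
  have hdown (k i : Fin n) (hki : i < k) (T : Subsemiring Γ(X', (U k).1))
      (h1 : specHom ρ (U k).1 (coord W n 1) ∈ T) (h2 : v k ∈ T) := by
    have := exists_mul_of_gt (θ := evalAt j (U k).1 (hU k)) (T := T) (i := i)
      (s := specHom ρ (U k).1 (coord W n 2)) (f := fun i ↦ algebraMap _ L (blowupGenerator W n i))
      (by rw [hφ']; exact hY) (by rw [hφ', hφ']; exact hrel) (by rw [hφ', hφ']; exact hv k)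
      (huv k) h1 h2 hki k.2
    exact this
  have hgen (k : Fin n) : Function.Surjective
      (MvPolynomial.eval₂Hom (specHom ρ (U k).1) ![u k, v k]) := by
    intro b
    change b ∈ (MvPolynomial.eval₂Hom (specHom ρ (U k).1) ![u k, v k]).rangeS
    have hT (a) : specHom ρ (U k).1 a ∈
        (MvPolynomial.eval₂Hom (specHom ρ (U k).1) ![u k, v k]).rangeS :=
      ⟨.C a, by simp⟩
    have huT : u k ∈ (MvPolynomial.eval₂Hom (specHom ρ (U k).1) ![u k, v k]).rangeS :=
      ⟨.X 0, by simp⟩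
    have hvT : v k ∈ (MvPolynomial.eval₂Hom (specHom ρ (U k).1) ![u k, v k]).rangeS :=
      ⟨.X 1, by simp⟩
    obtain ⟨m, a, ha, hb⟩ := hrange k b
    obtain ⟨t, ht, h⟩ := exists_mul_pow_eq_of_mem_span_pow (specHom ρ (U k).1) (hφ k) hT
      (fun i : Fin n ↦ blowupGenerator W n i) (algebraMap _ L (blowupGenerator W n k)) (fun i ↦ by
        obtain hki | rfl | hki := lt_trichotomy k i
        · obtain ⟨c, hc, h⟩ := hup k i hki _ (hT _) huT
          exact ⟨_, mul_mem huT hc, h⟩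
        · exact ⟨1, Subsemiring.one_mem _, by rw [map_one, one_mul]⟩
        · obtain ⟨c, hc, h, -⟩ := hdown k i hki _ (hT _) hvT
          exact ⟨_, mul_mem hvT hc, h⟩) m a ha
    rw [← hb] at h
    rwa [← hinj k (((hf k).pow m).mul_right_cancel h)]
  refine ⟨X', ρ, U, fun k ↦ ![u k, v k], hρ, htop, fun k ↦ ?_,
    fun k a b hab ↦ hAL (by rw [← hφ' k, ← hφ' k, hab]), fun i k ↦ ?_, fun i k h ↦ ?_,
    fun i k h ↦ ?_⟩
  · refine IsChart.of_injective k.2 (specHom ρ (U k).1) _ (evalAt j (U k).1 (hU k)) (hinj k) (hφ k)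
      (hinj k ?_) (hinj k ?_) (hgen k)
    · rw [map_mul, map_pow, hφ', hφ']
      exact hu k
    · rw [map_mul, map_pow, hφ', hφ']
      exact hv k
  · refine ⟨g i k, hgU i k, fun hik ↦ ?_, fun hik ↦ ?_, fun hk ↦ ?_⟩
    · obtain ⟨c, -, h⟩ := hup i k hik ⊤ trivial trivial
      rw [← hg i k] at h
      exact ⟨c, (hinj i ((hf i).mul_right_cancel h)).symm⟩
    · obtain ⟨c, -, h, hc⟩ := hdown i k (Fin.lt_def.mpr (by omega)) ⊤ trivial trivial
      rw [← hg i k] at h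
      rw [← hinj i ((hf i).mul_right_cancel h)]
      exact (hc hik).mul_left _
    · refine ⟨i, specHom ρ (U i).1 (∏ j ∈ Finset.range i, coord W n 1 ^ (j + 1)), hinj i ?_⟩
      refine (hS.pow (n - 1 - i)).mul_right_cancel ?_
      have e : n - 1 = i + (n - 1 - i) := by omega
      have h1 := hg i k
      rw [hk, blowupGenerator, blowupGenerator, Finset.range_zero, Finset.prod_empty, mul_one,
        Nat.sub_zero, map_mul, map_pow, map_pow] at h1
      rw [map_pow, hφ', map_mul, hφ', ← pow_add, ← e, ← h1]
      ring
  · exact huU i k h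
  · have h' : j ⁻¹ᵁ ((U i).1 ⊓ (U k).1) = ⊤ := by
      rw [Scheme.Hom.preimage_inf, hU, hU, inf_top_eq]
    apply evalAt_injective_of_eq_basicOpen j (U i).2 (hU i) (hinj i) (g i k) (hgU i k) h'
    rw [evalAt_map j (hU k) h', evalAt_map j (hU i) h']
    change evalAt j _ (hU k) (u k) = evalAt j _ (hU i) (u i ^ 2 * v i)
    refine hS.mul_right_cancel ?_
    have h1 := congr(evalAt j _ (hU i) $(huv i))
    rw [hφ', map_mul] at h1
    rw [hu, h, pow_succ, ← hu i, h1, map_mul, map_pow]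
    ring

end Charts

/-! ### Ideal sheaves -/

section IdealSheaf

variable {X Y : Scheme.{u}}

lemma ideal_comap_top_of_isAffine [IsAffine X] [IsAffine Y] (I : Y.IdealSheafData) (f : X ⟶ Y) :
    (I.comap f).ideal ⟨⊤, isAffineOpen_top X⟩ =
      (I.ideal ⟨⊤, isAffineOpen_top Y⟩).map (f.appLE ⊤ ⊤ le_top).hom := by
  refine eq_of_forall_ge_iff fun J ↦ ?_
  obtain ⟨J, rfl⟩ : ∃ J' : X.IdealSheafData, J'.ideal ⟨⊤, isAffineOpen_top X⟩ = J :=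
    ⟨.ofIdealTop J, by simp⟩
  rw [Ideal.map_le_iff_le_comap]
  have h1 : (J.map f).ideal ⟨⊤, isAffineOpen_top Y⟩ =
      (J.ideal ⟨⊤, isAffineOpen_top X⟩).comap (f.appLE ⊤ ⊤ le_top).hom := by
    rw [J.ideal_map f ⟨⊤, isAffineOpen_top Y⟩ (isAffineOpen_top X)]
    simp [Scheme.Hom.appLE]
    rfl
  rw [← h1]
  constructor
  · intro h
    exact Scheme.IdealSheafData.le_map_iff_comap_le.mpr (Scheme.IdealSheafData.le_of_isAffine h) _
  · intro h
    exact Scheme.IdealSheafData.le_map_iff_comap_le.mp (Scheme.IdealSheafData.le_of_isAffine h) _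

lemma ideal_comap_ι (I : X.IdealSheafData) (U : X.affineOpens) [IsAffine U.1] :
    (I.comap U.1.ι).ideal ⟨⊤, isAffineOpen_top U.1⟩ =
      (I.ideal U).map (U.1.ι.appLE U.1 ⊤ (by simp)).hom := by
  rw [Scheme.IdealSheafData.ideal_comap_of_isOpenImmersion, Scheme.Opens.ι_appIso,
    Scheme.Opens.ι_appLE]
  exact (I.map_ideal (U := ⟨U.1.ι ''ᵁ ⊤, (isAffineOpen_top U.1).image_of_isOpenImmersion U.1.ι⟩)
    (V := U) (by simp)).symm

/-- The inverse image of an ideal sheaf is generated by the pull-backs of its local sections. -/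
lemma ideal_comap_eq_map (I : Y.IdealSheafData) (f : X ⟶ Y) (V : Y.affineOpens)
    (U : X.affineOpens) (h : U.1 ≤ f ⁻¹ᵁ V.1) :
    (I.comap f).ideal U = (I.ideal V).map (f.appLE V.1 U.1 h).hom := by
  have hU : IsAffine U.1 := U.2
  have hV : IsAffine V.1 := V.2
  have h1 : (I.comap f).comap U.1.ι = (I.comap V.1.ι).comap (f.resLE V.1 U.1 h) := by
    rw [← Scheme.IdealSheafData.comap_comp, ← Scheme.IdealSheafData.comap_comp,
      Scheme.Hom.resLE_comp_ι]
  have h2 := congr($(h1).ideal ⟨⊤, isAffineOpen_top U.1⟩)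
  have h3 := ideal_comap_top_of_isAffine (I.comap V.1.ι) (f.resLE V.1 U.1 h)
  have h4 : V.1.ι.appLE V.1 ⊤ (by simp) ≫ (f.resLE V.1 U.1 h).appLE ⊤ ⊤ le_top =
      f.appLE V.1 U.1 h ≫ U.1.ι.appLE U.1 ⊤ (by simp) := by
    refine (Scheme.Hom.appLE_comp_appLE _ _ _ _ _ _ _).trans
      (Eq.trans ?_ (Scheme.Hom.appLE_comp_appLE _ _ _ _ _ _ _).symm)
    simp only [Scheme.Hom.resLE_comp_ι]
  rw [ideal_comap_ι, h3, ideal_comap_ι, Ideal.map_map, ← CommRingCat.hom_comp] at h2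
  replace h2 := h2.trans congr(Ideal.map (CommRingCat.Hom.hom $h4) (I.ideal V))
  rw [CommRingCat.hom_comp, ← Ideal.map_map] at h2
  have h5 : Function.Bijective (U.1.ι.appLE U.1 ⊤ (by simp)).hom := by
    have : IsIso (U.1.ι.appLE U.1 ⊤ (by simp)) := by
      have : U.1.ι.appLE U.1 ⊤ (by simp) = U.1.topIso.inv := by
        rw [Scheme.Opens.ι_appLE]; simp; rfl
      rw [this]
      infer_instance
    exact ConcreteCategory.bijective_of_isIso _
  have h6 := congr(Ideal.comap (U.1.ι.appLE U.1 ⊤ (by simp)).hom $h2)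
  rwa [Ideal.comap_map_of_bijective _ h5, Ideal.comap_map_of_bijective _ h5] at h6

lemma ideal_prod {ι : Type*} (s : Finset ι) (E : ι → X.IdealSheafData) (U : X.affineOpens) :
    (∏ i ∈ s, E i).ideal U = ∏ i ∈ s, (E i).ideal U := by
  classical
  induction s using Finset.induction_on with
  | empty => simp
  | insert i s hi ih =>
    rw [Finset.prod_insert hi, Finset.prod_insert hi, Scheme.IdealSheafData.ideal_mul, ← ih]
    rfl

/-- Over a principal open subset, ideal membership is membership up to powers. -/
lemma exists_dvd_pow_mul {V W : X.Opens} (hV : IsAffineOpen V) (g : Γ(X, V)) (hWV : W ≤ V)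
    (hW : W = X.basicOpen g) (a w : Γ(X, V))
    (h : X.presheaf.map (homOfLE hWV).op a ∈ Ideal.span {X.presheaf.map (homOfLE hWV).op w}) :
    ∃ N, w ∣ g ^ N * a := by
  subst hW
  obtain ⟨c, hc⟩ := Ideal.mem_span_singleton.mp h
  obtain ⟨N, b, hb⟩ := exists_pow_mul_eq_map hV g c
  have := hV.isLocalization_basicOpen g
  have h1 : X.presheaf.map (homOfLE (X.basicOpen_le g)).op (g ^ N * a) =
      X.presheaf.map (homOfLE (X.basicOpen_le g)).op (w * b) := by
    rw [map_mul, map_mul, hb, map_pow, hc]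
    ring
  obtain ⟨⟨_, M, rfl⟩, h2⟩ := IsLocalization.exists_of_eq (M := Submonoid.powers g)
    (S := Γ(X, X.basicOpen g)) h1
  refine ⟨M + N, g ^ M * b, ?_⟩
  rw [pow_add, mul_assoc]
  refine h2.trans ?_
  simp only
  ring

/-- The closure of a principal closed subscheme of an affine open subscheme. -/
lemma exists_closure_zeroLocus [X.IsSeparated] (U : X.affineOpens) (u : Γ(X, U.1)) :
    ∃ E : X.IdealSheafData, ∀ (V : X.affineOpens) (W : X.Opens) (hWU : W ≤ U.1) (hWV : W ≤ V.1)
      (_ : W = U.1 ⊓ V.1) (a : Γ(X, V.1)), a ∈ E.ideal V ↔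
        X.presheaf.map (homOfLE hWV).op a ∈ Ideal.span {X.presheaf.map (homOfLE hWU).op u} := by
  have hU : IsAffine U.1 := U.2
  let I : U.1.toScheme.IdealSheafData :=
    .ofIdealTop (Ideal.span {U.1.ι.appLE U.1 ⊤ (by simp) u})
  refine ⟨I.map U.1.ι, fun V W hWU hWV hW a ↦ ?_⟩
  have hV : IsAffineOpen (U.1.ι ⁻¹ᵁ V.1) := by
    rw [← Scheme.Hom.isAffineOpen_iff_of_isOpenImmersion U.1.ι,
      Scheme.Hom.image_preimage_eq_opensRange_inf, Scheme.Opens.opensRange_ι]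
    exact U.2.inf V.2
  rw [I.ideal_map U.1.ι V hV]
  subst hW
  have h0 : U.1.ι ⁻¹ᵁ V.1 ≤ U.1.ι ⁻¹ᵁ (U.1 ⊓ V.1) := fun z hz ↦ ⟨z.2, hz⟩
  have hκ : IsIso (U.1.ι.appLE (U.1 ⊓ V.1) (U.1.ι ⁻¹ᵁ V.1) h0) := by
    rw [Scheme.Opens.ι_appLE]
    have h1 : U.1.ι ''ᵁ (U.1.ι ⁻¹ᵁ V.1) = U.1 ⊓ V.1 := by
      rw [Scheme.Hom.image_preimage_eq_opensRange_inf, Scheme.Opens.opensRange_ι]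
    exact (X.presheaf.mapIso (Iso.op (X := U.1.ι ''ᵁ (U.1.ι ⁻¹ᵁ V.1)) (Y := U.1 ⊓ V.1)
      ⟨homOfLE h1.le, homOfLE h1.ge, Subsingleton.elim _ _, Subsingleton.elim _ _⟩)).isIso_hom
  obtain ⟨κ, hκ1, hκ2⟩ : ∃ κ : Γ(X, U.1 ⊓ V.1) ≃+* Γ(U.1, U.1.ι ⁻¹ᵁ V.1),
      (∀ a, U.1.ι.app V.1 a = κ (X.presheaf.map (homOfLE hWV).op a)) ∧
      (U.1.toScheme.presheaf.map (homOfLE le_top).op (U.1.ι.appLE U.1 ⊤ (by simp) u)) =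
        κ (X.presheaf.map (homOfLE hWU).op u) := by
    refine ⟨(asIso (U.1.ι.appLE (U.1 ⊓ V.1) (U.1.ι ⁻¹ᵁ V.1) h0)).commRingCatIsoToRingEquiv,
      fun a ↦ ?_, ?_⟩
    · have := Scheme.Hom.map_appLE U.1.ι (U' := V.1) (V := U.1.ι ⁻¹ᵁ V.1) (U := U.1 ⊓ V.1)
        h0 (homOfLE hWV).op
      rw [Scheme.Hom.appLE_eq_app] at this
      exact congr($(this.symm) a)
    · have h1 := Scheme.Hom.map_appLE U.1.ι (U' := U.1) (V := U.1.ι ⁻¹ᵁ V.1) (U := U.1 ⊓ V.1)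
        h0 (homOfLE hWU).op
      have h2 := Scheme.Hom.appLE_map U.1.ι (U := U.1) (V := ⊤) (V' := U.1.ι ⁻¹ᵁ V.1)
        (by simp) (homOfLE le_top).op
      exact congr($(h2.trans h1.symm) u)
  rw [Ideal.mem_comap, Scheme.IdealSheafData.ofIdealTop_ideal, Ideal.map_span, Set.image_singleton]
  change U.1.ι.app V.1 a ∈ Ideal.span {U.1.toScheme.presheaf.map (homOfLE le_top).op
    (U.1.ι.appLE U.1 ⊤ (by simp) u)} ↔ _
  rw [hκ1, hκ2, Ideal.mem_span_singleton, Ideal.mem_span_singleton, map_dvd_iff]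

end IdealSheaf

section Singularity

variable {W : Type u} [CommRing W] {n : ℕ} {X' : Scheme.{u}} (ρ : X' ⟶ X W n)

lemma ideal_comap_closedSub (I : Ideal (R W n)) (U : X'.affineOpens) :
    ((closedSub W n I).comap ρ).ideal U = I.map (specHom ρ U.1) := by
  rw [ideal_comap_eq_map _ ρ ⟨⊤, isAffineOpen_top _⟩ U le_top, closedSub,
    Scheme.IdealSheafData.ofIdealTop_ideal, Ideal.map_map, Ideal.map_map, ← CommRingCat.hom_comp,
    ← CommRingCat.hom_comp, specHom]
  congr 2

lemma structureHom_comp_toBase (U : X'.Opens) :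
    structureHom (ρ ≫ toBase W n) U = (specHom ρ U).comp (algebraMap W (R W n)) := by
  rw [structureHom, specHom, ← CommRingCat.hom_ofHom (algebraMap W (R W n)), ← CommRingCat.hom_comp]
  congr 1
  rw [Scheme.Hom.comp_appTop, toBase, Category.assoc, ← Scheme.ΓSpecIso_inv_naturality_assoc]
  rfl

lemma structureHom_comp {Y : Scheme.{u}} (f : Y ⟶ X') (p : X' ⟶ Spec (.of W)) (U : X'.Opens) :
    structureHom (f ≫ p) (f ⁻¹ᵁ U) = (f.app U).hom.comp (structureHom p U) := by
  rw [structureHom, structureHom, ← CommRingCat.hom_comp]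
  congr 1
  simp only [Scheme.Hom.comp_appTop, Category.assoc, Scheme.Hom.naturality]
  rfl

lemma originIdeal_le_of_isMaximal (m : Ideal (R W n)) [hm : m.IsMaximal] :
    originIdeal W n ≤ m := by
  have h (i : Fin 3) : coord W n i ∈ m := by
    by_contra hi
    obtain ⟨y, z, hz, h⟩ := hm.exists_inv hi
    obtain ⟨F, rfl⟩ := Ideal.Quotient.mk_surjective y
    -- `1 - F * X i` has the constant coefficient `1`, hence is a unit
    have h1 : z = Ideal.Quotient.mk _ (1 - F * MvPowerSeries.X i) := by
      rw [map_sub, map_one, map_mul, ← h, coord]; ring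
    have h2 : IsUnit (1 - F * MvPowerSeries.X i : PS W) := by
      rw [MvPowerSeries.isUnit_iff_constantCoeff]; simp
    exact hm.ne_top (Ideal.eq_top_of_isUnit_mem _ hz (h1 ▸ h2.map _))
  rw [originIdeal, Ideal.span_le]
  rintro _ (rfl | rfl | rfl) <;> exact h _

lemma mem_support_closedSub (I : Ideal (R W n)) (z : X W n) :
    z ∈ (closedSub W n I).support ↔ I ≤ z.asIdeal := by
  rw [← SetLike.mem_coe, closedSub, Scheme.IdealSheafData.coe_support_ofIdealTop, Spec_zeroLocus,
    ← Ideal.coe_comap, Ideal.comap_map_of_bijective _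
      (ConcreteCategory.bijective_of_isIso (Scheme.ΓSpecIso (.of (R W n))).inv)]
  rfl

/-- All closed points of `X` lie on the origin `O`, hence so do the images of all closed subsets of
a proper scheme over `X`. -/
lemma eq_top_of_support_comap_le [UniversallyClosed ρ] (V : X'.Opens)
    (h : (((origin W n).comap ρ).support : Set X') ⊆ V) : V = ⊤ := by
  by_contra hV
  obtain ⟨z, hz⟩ : ∃ z, z ∉ V := by
    by_contra! hz
    exact hV (eq_top_iff.mpr fun z _ ↦ hz z)
  have hc : IsClosed (ρ '' (V : Set X')ᶜ) := ρ.isClosedMap _ V.isOpen.isClosed_compl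
  obtain ⟨m, hm, hzm⟩ := Ideal.exists_le_maximal (ρ z).asIdeal (ρ z).2.ne_top
  have h1 : (⟨m, hm.isPrime⟩ : PrimeSpectrum (R W n)) ∈ ρ '' (V : Set X')ᶜ :=
    ((PrimeSpectrum.le_iff_specializes (ρ z) ⟨m, hm.isPrime⟩).mp hzm).mem_closed hc ⟨z, hz, rfl⟩
  obtain ⟨z', hz', hz'm⟩ := h1
  refine hz' (h ?_)
  rw [Scheme.IdealSheafData.support_comap]
  change ρ z' ∈ (origin W n).support
  rw [hz'm]
  exact (mem_support_closedSub _ _).mpr (originIdeal_le_of_isMaximal m)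

end Singularity

/-! ### The components of the divisor of `s` -/

section

variable {W : Type u} [CommRing W] {n : ℕ} {X' : Scheme.{u}} (ρ : X' ⟶ X W n)

lemma basicOpen_specHom (V : X'.Opens) (r : R W n) :
    X'.basicOpen (specHom ρ V r) = V ⊓ ρ ⁻¹ᵁ PrimeSpectrum.basicOpen r := by
  refine (Scheme.basicOpen_appLE ρ V ⊤ le_top _).trans ?_
  rw [basicOpen_eq_of_affine']
  exact congr(V ⊓ ρ ⁻¹ᵁ PrimeSpectrum.basicOpen
    $((Scheme.ΓSpecIso (.of (R W n))).commRingCatIsoToRingEquiv.apply_symm_apply r))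

lemma ι_app_eq_zero_iff {Z : Scheme.{u}} {O : Z.Opens} {r : Γ(Z, ⊤)} (hO : O = Z.basicOpen r)
    {V : Z.Opens} (hV : IsAffineOpen V) (b : Γ(Z, V)) :
    O.ι.app V b = 0 ↔ ∃ N, Z.presheaf.map (homOfLE le_top).op r ^ N * b = 0 := by
  have h1 : O.ι ''ᵁ (O.ι ⁻¹ᵁ V) = Z.basicOpen (Z.presheaf.map (homOfLE (le_top : V ≤ ⊤)).op r) := by
    rw [Scheme.Hom.image_preimage_eq_opensRange_inf, Scheme.Opens.opensRange_ι, hO,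
      Scheme.basicOpen_res, inf_comm]
  have h2 : O.ι ''ᵁ (O.ι ⁻¹ᵁ V) ≤ V := h1.le.trans (Z.basicOpen_le _)
  change Z.presheaf.map (homOfLE h2).op b = 0 ↔ _
  constructor
  · intro h
    obtain ⟨N, hN⟩ := exists_dvd_pow_mul hV _ h2 h1 b 0 (by rw [h]; exact zero_mem _)
    exact ⟨N, zero_dvd_iff.mp hN⟩
  · rintro ⟨N, hN⟩
    have h3 := congr(Z.presheaf.map (homOfLE h2).op $hN)
    rw [map_mul, map_pow, map_zero] at h3
    refine (IsUnit.mul_right_eq_zero (IsUnit.pow N ?_)).mp h3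
    generalize O.ι ''ᵁ (O.ι ⁻¹ᵁ V) = V' at h1 h2
    subst h1
    exact RingedSpace.isUnit_res_basicOpen _ _

lemma specHom_comp {Y : Scheme.{u}} (f : Y ⟶ X') (V : X'.Opens) (r : R W n) :
    specHom (f ≫ ρ) (f ⁻¹ᵁ V) r = f.app V (specHom ρ V r) := by
  have := Scheme.Hom.appLE_comp_appLE f ρ ⊤ V (f ⁻¹ᵁ V) le_top le_rfl
  rw [Scheme.Hom.appLE_eq_app] at this
  exact congr($(this.symm) ((Scheme.ΓSpecIso (.of (R W n))).inv r))

/-- On `C`, the complement of the origin is the locus where `x` is invertible. -/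
lemma preimage_compl_support_origin :
    ((C W n).comap ρ).subschemeι ⁻¹ᵁ (ρ ⁻¹ᵁ (origin W n).support.compl) =
      Scheme.basicOpen _ (specHom (((C W n).comap ρ).subschemeι ≫ ρ) ⊤ (coord W n 0)) := by
  rw [basicOpen_specHom, top_inf_eq]
  ext z
  have hz : ρ (((C W n).comap ρ).subschemeι z) ∈ (C W n).support := by
    have h1 : ((C W n).comap ρ).subschemeι z ∈ ((C W n).comap ρ).support := by
      rw [← SetLike.mem_coe, ← Scheme.IdealSheafData.range_subschemeι]
      exact ⟨z, rfl⟩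
    rwa [Scheme.IdealSheafData.support_comap] at h1
  replace hz := (mem_support_closedSub _ _).mp hz
  rw [Ideal.span_le, Set.pair_subset_iff] at hz
  change ¬ (ρ (((C W n).comap ρ).subschemeι z) ∈ (origin W n).support) ↔
    coord W n 0 ∉ (ρ (((C W n).comap ρ).subschemeι z)).asIdeal
  rw [origin, mem_support_closedSub, Ideal.span_le, not_iff_not]
  simp only [Set.insert_subset_iff, Set.singleton_subset_iff]
  tauto

/-- The local sections of the ideal of the proper transform: outside the inverse image of the
origin, which is the zero locus of `x` on the inverse image of `C`, they lie in the ideal of `C`. -/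
lemma mem_ideal_properTransform (V : X'.affineOpens) (a : Γ(X', V.1)) :
    a ∈ (properTransform ρ).ideal V ↔ ∃ N, specHom ρ V.1 (coord W n 0) ^ N * a ∈
      (Ideal.span {coord W n 2, coord W n 1}).map (specHom ρ V.1) := by
  have hqc : QuasiCompact (((C W n).comap ρ).subschemeι ⁻¹ᵁ
      (ρ ⁻¹ᵁ (origin W n).support.compl)).ι := by
    rw [preimage_compl_support_origin]
    infer_instance
  have hV : IsAffineOpen (((C W n).comap ρ).subschemeι ⁻¹ᵁ V.1) := V.2.preimage _
  have hker (b : Γ(X', V.1)) : ((C W n).comap ρ).subschemeι.app V.1 b = 0 ↔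
      b ∈ (Ideal.span {coord W n 2, coord W n 1}).map (specHom ρ V.1) := by
    rw [← ideal_comap_closedSub, ← Scheme.IdealSheafData.ker_subschemeι_app]
    rfl
  rw [properTransform, Scheme.Hom.ker_apply, RingHom.mem_ker]
  have h1 := ι_app_eq_zero_iff (preimage_compl_support_origin ρ) hV
    (((C W n).comap ρ).subschemeι.app V.1 a)
  rw [Scheme.Hom.comp_app]
  refine h1.trans (exists_congr fun N ↦ ?_)
  rw [← hker, map_mul, map_pow, ← specHom_comp, specHom_map]

end

namespace AreCharts

variable {W : Type u} [CommRing W] {n : ℕ} {X' : Scheme.{u}} {ρ : X' ⟶ X W n}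
  {U : Fin n → X'.affineOpens} {x : ∀ k, Fin 2 → Γ(X', (U k).1)}

/-- The equation of the `i`-th component in the `k`-th chart: the component `i` is `{u = 0}` in the
chart `i` and `{v = 0}` in the chart `i - 1`, and it does not meet the other charts. -/
def componentEq (x : ∀ k, Fin 2 → Γ(X', (U k).1)) (k : Fin n) (i : ℕ) : Γ(X', (U k).1) :=
  if k.1 = i then x k 0 else if k.1 + 1 = i then x k 1 else 1

lemma isSeparated (h : AreCharts ρ U x) : X'.IsSeparated := by
  have := h.isProper
  rw [Scheme.isSeparated_iff, ← Limits.terminal.comp_from ρ]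
  infer_instance

/-- The exceptional component `i` is the closure of `{u = 0}` in the chart `i`. -/
theorem exists_ideal_eq_span (h : AreCharts ρ U x) (i : Fin n) :
    ∃ E : X'.IdealSheafData, ∀ k, E.ideal (U k) = Ideal.span {componentEq x k i} := by
  have := h.isSeparated
  obtain ⟨E, hE⟩ := exists_closure_zeroLocus (U i) (x i 0)
  refine ⟨E, fun k ↦ ?_⟩
  -- the equation becomes a unit on the overlap with a chart that does not meet the component
  have htop (hik : i < k ∨ k.1 + 1 < i) : E.ideal (U k) = ⊤ := by
    refine eq_top_iff.mpr fun a _ ↦ ?_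
    rw [hE (U k) ((U i).1 ⊓ (U k).1) inf_le_left inf_le_right rfl]
    obtain ⟨g, hg, h1, h2, -⟩ := h.exists_inf_eq i k
    have hdvd : x i 0 ∣ g := hik.elim h1 h2
    have hunit : IsUnit (X'.presheaf.map (homOfLE (inf_le_left : (U i).1 ⊓ (U k).1 ≤ _)).op g) := by
      generalize_proofs hle
      revert hle
      rw [hg]
      exact fun _ ↦ RingedSpace.isUnit_res_basicOpen _ g
    have h3 := isUnit_of_dvd_unit (map_dvd (X'.presheaf.map
      (homOfLE (inf_le_left : (U i).1 ⊓ (U k).1 ≤ _)).op).hom hdvd) hunit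
    exact (Ideal.eq_top_of_isUnit_mem _ (Ideal.mem_span_singleton_self _) h3).symm ▸ trivial
  obtain hik | rfl | hik := lt_trichotomy i k
  · rw [htop (.inl hik), componentEq, if_neg (by omega), if_neg (by omega), Ideal.span_singleton_one]
  · ext a
    rw [hE (U i) (U i).1 le_rfl le_rfl (inf_idem _).symm, componentEq, if_pos rfl]
    simp
  · by_cases hki : k.1 + 1 = i
    · have hinf := h.inf_succ k i hki.symm
      have hmap := h.map_succ k i hki.symm
      rw [componentEq, if_neg (by omega), if_pos hki]
      have hunit : IsUnit (X'.presheaf.map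
          (homOfLE (inf_le_left : (U k).1 ⊓ (U i).1 ≤ _)).op (x k 0)) := by
        generalize_proofs hle
        revert hle
        rw [hinf]
        exact fun _ ↦ RingedSpace.isUnit_res_basicOpen _ _
      have hspan : Ideal.span {X'.presheaf.map
          (homOfLE (inf_le_right : (U k).1 ⊓ (U i).1 ≤ (U i).1)).op (x i 0)} =
          Ideal.span {X'.presheaf.map
          (homOfLE (inf_le_left : (U k).1 ⊓ (U i).1 ≤ (U k).1)).op (x k 1)} := by
        rw [hmap, map_mul, map_pow, Ideal.span_singleton_mul_left_unit (hunit.pow 2)]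
      ext a
      rw [hE (U k) ((U k).1 ⊓ (U i).1) inf_le_right inf_le_left (inf_comm _ _), hspan]
      constructor
      · intro ha
        obtain ⟨N, hN⟩ := exists_dvd_pow_mul (U k).2 (x k 0) inf_le_left hinf a _ ha
        exact Ideal.mem_span_singleton.mpr ((h.isChart k).dvd_of_dvd_pow_mul N hN)
      · intro ha
        rw [Ideal.mem_span_singleton] at ha ⊢
        exact map_dvd _ ha
    · have hlt : k.1 + 1 < i := by have := Fin.lt_def.mp hik; omega
      rw [htop (.inr hlt), componentEq, if_neg (by omega), if_neg hki, Ideal.span_singleton_one]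

/-- The proper transform of `C` is `{v = 0}` in the last chart, and it does not meet the other
charts. -/
theorem ideal_properTransform (h : AreCharts ρ U x) (k : Fin n) :
    (properTransform ρ).ideal (U k) = Ideal.span {componentEq x k n} := by
  have hc := h.isChart k
  have hk := k.2
  ext a
  rw [mem_ideal_properTransform, componentEq, if_neg (by omega), Ideal.map_span, Set.image_pair]
  split_ifs with hkn
  · rw [Ideal.mem_span_singleton]
    have hx : specHom ρ (U k).1 (coord W n 0) = x k 0 := by
      have e : n - k = 1 := by omega
      rw [hc.map_x, e]; simp
    constructor
    · rintro ⟨N, hN⟩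
      refine hc.dvd_of_dvd_pow_mul N ?_
      rw [← hx, ← Ideal.mem_span_singleton]
      refine Ideal.span_le.mpr ?_ hN
      rintro _ (rfl | rfl)
      · rw [SetLike.mem_coe, Ideal.mem_span_singleton, hc.map_s]
        exact (dvd_pow_self _ k.1.succ_ne_zero).mul_left _
      · rw [SetLike.mem_coe, Ideal.mem_span_singleton, hc.map_y]
        exact Dvd.intro_left _ rfl
    · rintro ⟨c, rfl⟩
      refine ⟨1, ?_⟩
      rw [hx, pow_one, ← mul_assoc, ← hc.map_y]
      exact Ideal.mul_mem_right _ _ (Ideal.subset_span (by simp))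
  · rw [Ideal.span_singleton_one]
    refine iff_of_true ⟨1, Ideal.mul_mem_right _ _ ?_⟩ trivial
    obtain ⟨m, hm⟩ : ∃ m, n - k.1 = m + 2 := ⟨n - k - 2, by omega⟩
    have h1 : specHom ρ (U k).1 (coord W n 0) =
        specHom ρ (U k).1 (coord W n 1) * (x k 0 ^ (m + 1) * x k 1 ^ m) := by
      rw [hc.map_x, hc.map_y, hm, show m + 2 - 1 = m + 1 from rfl]
      ring
    rw [pow_one, h1]
    exact Ideal.mul_mem_right _ _ (Ideal.subset_span (by simp))

end AreCharts

/-! ### Reading off the divisor in the charts -/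

lemma eq_top_of_support_comap_comap_le {W : Type u} [CommRing W] {n : ℕ} {X' Y : Scheme.{u}}
    (ρ : X' ⟶ X W n) [UniversallyClosed ρ] (f : Y ⟶ X') [UniversallyClosed f] (V : Y.Opens)
    (h : ((((origin W n).comap ρ).comap f).support : Set Y) ⊆ V) : V = ⊤ := by
  rw [← Scheme.IdealSheafData.comap_comp] at h
  exact eq_top_of_support_comap_le (f ≫ ρ) V h

lemma notMem_of_ideal_eq_top {Y : Scheme.{u}} {I : Y.IdealSheafData} {V : Y.affineOpens}
    (hI : I.ideal V = ⊤) (z : I.subscheme) : I.subschemeι z ∉ V.1 := by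
  intro hk
  have hz : I.subschemeι z ∈ I.support := by
    rw [← SetLike.mem_coe, ← Scheme.IdealSheafData.range_subschemeι]
    exact ⟨z, rfl⟩
  rw [Scheme.IdealSheafData.mem_support_iff_of_mem hk, hI] at hz
  simp at hz
  exact hz hk

/-- `C` and the divisor of `s` have the same support, because `y ^ n = s x`. -/
lemma support_divS {W : Type u} [CommRing W] {n : ℕ} :
    (divS W n).support = (C W n).support := by
  ext z
  refine (mem_support_closedSub _ z).trans (Iff.trans ?_ (mem_support_closedSub _ z).symm)
  rw [Ideal.span_le, Ideal.span_le, Set.pair_subset_iff, Set.singleton_subset_iff]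
  refine ⟨fun h ↦ ⟨h, ?_⟩, fun h ↦ h.1⟩
  refine z.2.mem_of_pow_mem n ?_
  rw [← coord_relation]
  exact Ideal.mul_mem_right _ _ h

namespace AreCharts

variable {W : Type u} [CommRing W] {n : ℕ} {X' : Scheme.{u}} {ρ : X' ⟶ X W n}
  {U : Fin n → X'.affineOpens} {x : ∀ k, Fin 2 → Γ(X', (U k).1)} {E : ℕ → X'.IdealSheafData}

lemma prod_componentEq_pow (x : ∀ k, Fin 2 → Γ(X', (U k).1)) (k : Fin n) (m : ℕ → ℕ) :
    ∏ i ∈ Finset.Icc 1 n, componentEq x k i ^ m i =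
      (if 0 < k.1 then x k 0 ^ m k else 1) * x k 1 ^ m (k + 1) := by
  have hk := k.2
  have h (i : ℕ) : componentEq x k i ^ m i =
      (if k.1 = i then x k 0 ^ m i else 1) * (if k.1 + 1 = i then x k 1 ^ m i else 1) := by
    rw [componentEq]
    split_ifs <;> first | omega | simp
  rw [Finset.prod_congr rfl fun i _ ↦ h i, Finset.prod_mul_distrib, Finset.prod_ite_eq,
    Finset.prod_ite_eq, if_pos (Finset.mem_Icc.mpr ⟨by omega, hk⟩ : k.1 + 1 ∈ Finset.Icc 1 n)]
  congr 1
  refine if_congr ?_ rfl rfl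
  rw [Finset.mem_Icc]
  omega

lemma ideal_prod_pow (hE : ∀ i ∈ Finset.Icc 1 n, ∀ k, (E i).ideal (U k) =
    Ideal.span {componentEq x k i}) (k : Fin n) (m : ℕ → ℕ) :
    (∏ i ∈ Finset.Icc 1 n, E i ^ m i).ideal (U k) =
      Ideal.span {(if 0 < k.1 then x k 0 ^ m k else 1) * x k 1 ^ m (k + 1)} := by
  rw [ideal_prod, ← prod_componentEq_pow x k m, ← Ideal.prod_span_singleton]
  refine Finset.prod_congr rfl fun i hi ↦ ?_
  rw [← Ideal.span_singleton_pow, ← hE i hi k]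
  rfl

theorem comap_divS (h : AreCharts ρ U x) (hE : ∀ i ∈ Finset.Icc 1 n, ∀ k, (E i).ideal (U k) =
    Ideal.span {componentEq x k i}) : (divS W n).comap ρ = ∏ i ∈ Finset.Icc 1 n, E i ^ i := by
  refine Scheme.IdealSheafData.ext_of_iSup_eq_top U h.iSup_eq_top fun k ↦ ?_
  rw [ideal_prod_pow hE k fun i ↦ i, divS, ideal_comap_closedSub, Ideal.map_span,
    Set.image_singleton, (h.isChart k).map_s]
  congr 2
  obtain hk | hk := Nat.eq_zero_or_pos k.1
  · simp [hk]
  · rw [if_pos hk]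

theorem isLocalCoordinates (h : AreCharts ρ U x) (k : Fin n) :
    IsLocalCoordinates (structureHom (ρ ≫ toBase W n) (U k).1)
      (((origin W n).comap ρ).ideal (U k)) (x k) := by
  rw [structureHom_comp_toBase, origin, ideal_comap_closedSub]
  exact (h.isChart k).isLocalCoordinates

lemma exists_mem (h : AreCharts ρ U x) (z : X') : ∃ k, z ∈ (U k).1 := by
  have : z ∈ (⨆ k, (U k).1) := h.iSup_eq_top ▸ trivial
  simpa using this

theorem isSmoothOver (h : AreCharts ρ U x) :
    IsSmoothOver (ρ ≫ toBase W n) ((origin W n).comap ρ) 2 := by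
  have := h.isProper
  refine ⟨eq_top_of_support_comap_le ρ, fun z _ ↦ ?_⟩
  obtain ⟨k, hk⟩ := h.exists_mem z
  exact ⟨U k, hk, x k, h.isLocalCoordinates k⟩

theorem isRelativeNCD (h : AreCharts ρ U x) (hE : ∀ i ∈ Finset.Icc 1 n, ∀ k, (E i).ideal (U k) =
    Ideal.span {componentEq x k i}) :
    IsRelativeNCD (ρ ≫ toBase W n) ((origin W n).comap ρ) 2 (∏ i ∈ Finset.Icc 1 n, E i) := by
  have := h.isProper
  refine ⟨eq_top_of_support_comap_le ρ, fun z _ ↦ ?_⟩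
  obtain ⟨k, hk⟩ := h.exists_mem z
  refine ⟨U k, hk, x k, h.isLocalCoordinates k, if 0 < k.1 then Finset.univ else {1},
    prod_mem fun i _ ↦ (h.isChart k).mem_nonZeroDivisors i, ?_⟩
  have h1 := ideal_prod_pow hE k fun _ ↦ 1
  simp only [pow_one] at h1
  rw [h1]
  split_ifs
  · rw [Fin.prod_univ_two]
  · rw [Finset.prod_singleton, one_mul]

/-- A component meets only those charts in which it is the zero locus of a coordinate. -/
lemma exists_mem_of_subscheme (h : AreCharts ρ U x) {i : ℕ}
    (hE : ∀ k, (E i).ideal (U k) = Ideal.span {componentEq x k i}) (z : (E i).subscheme) :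
    ∃ (k : Fin n) (j : Fin 2), (E i).subschemeι z ∈ (U k).1 ∧ k.1 + j.1 = i ∧
      (E i).ideal (U k) = Ideal.span {x k j} := by
  obtain ⟨k, hk⟩ := h.exists_mem ((E i).subschemeι z)
  by_cases h0 : k.1 = i
  · exact ⟨k, 0, hk, h0, by rw [hE, componentEq, if_pos h0]⟩
  by_cases h1 : k.1 + 1 = i
  · exact ⟨k, 1, hk, h1, by rw [hE, componentEq, if_neg h0, if_pos h1]⟩
  refine (notMem_of_ideal_eq_top (V := U k) ?_ z hk).elim
  rw [hE, componentEq, if_neg h0, if_neg h1, Ideal.span_singleton_one]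

theorem isSmoothOver_subscheme (h : AreCharts ρ U x) {i : ℕ}
    (hE : ∀ k, (E i).ideal (U k) = Ideal.span {componentEq x k i}) :
    IsSmoothOver ((E i).subschemeι ≫ ρ ≫ toBase W n)
      (((origin W n).comap ρ).comap (E i).subschemeι) 1 := by
  have := h.isProper
  refine ⟨eq_top_of_support_comap_comap_le ρ _, fun z _ ↦ ?_⟩
  obtain ⟨k, j, hk, -, hj⟩ := h.exists_mem_of_subscheme hE z
  have h1 := (h.isLocalCoordinates k).of_surjective j ((E i).subschemeι.app (U k).1).hom
    ((E i).subschemeι_app_surjective (U k)) (by rw [(E i).ker_subschemeι_app, hj])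
  refine ⟨⟨(E i).subschemeι ⁻¹ᵁ (U k).1, (U k).2.preimage _⟩, hk,
    fun l ↦ (E i).subschemeι.app (U k).1 (x k (j.succAbove l)), ?_⟩
  rw [structureHom_comp, ideal_comap_eq_map _ _ (U k) _ le_rfl, Scheme.Hom.appLE_eq_app]
  exact h1

theorem sup_eq_top (h : AreCharts ρ U x) (hE : ∀ i ∈ Finset.Icc 1 n, ∀ k, (E i).ideal (U k) =
    Ideal.span {componentEq x k i}) {i j : ℕ} (hi : i ∈ Finset.Icc 1 n) (hj : j ∈ Finset.Icc 1 n)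
    (hij : i + 1 < j) : E i ⊔ E j = ⊤ := by
  refine Scheme.IdealSheafData.ext_of_iSup_eq_top U h.iSup_eq_top fun k ↦ ?_
  change (E i).ideal (U k) ⊔ (E j).ideal (U k) = ⊤
  rw [hE i hi, hE j hj, componentEq, componentEq]
  by_cases h1 : k.1 = i ∨ k.1 + 1 = i
  · rw [if_neg (show ¬ k.1 = j by omega), if_neg (show ¬ k.1 + 1 = j by omega),
      Ideal.span_singleton_one, sup_top_eq]
  · rw [if_neg (by tauto), if_neg (by tauto), Ideal.span_singleton_one, top_sup_eq]

theorem comap_origin_le (h : AreCharts ρ U x) {i : ℕ} (h0 : 0 < i) (hi : i < n)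
    (hE : ∀ k, (E i).ideal (U k) = Ideal.span {componentEq x k i}) :
    (origin W n).comap ρ ≤ E i := by
  refine Scheme.IdealSheafData.le_of_iSup_eq_top U h.iSup_eq_top fun k ↦ ?_
  rw [origin, ideal_comap_closedSub, hE, componentEq]
  split_ifs with h1 h2
  · exact (h.isChart k).map_originIdeal_le_span_zero (by omega)
  · exact (h.isChart k).map_originIdeal_le_span_one (by omega)
  · rw [Ideal.span_singleton_one]; exact le_top

end AreCharts

/-! ### Affine lines over the base -/

lemma isStandardSmoothOfRelativeDimension_of_bijective {A B : Type u} [CommRing A] [CommRing B]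
    {d : ℕ} (ψ : A →+* B) (t : Fin d → B)
    (h : Function.Bijective (MvPolynomial.eval₂Hom ψ t)) :
    ψ.IsStandardSmoothOfRelativeDimension d := by
  algebraize [ψ]
  let P' : Algebra.PreSubmersivePresentation A B (Fin d) PEmpty.{1} :=
  { toGenerators := .ofSurjective t h.2
    relation := PEmpty.elim
    span_range_relation_eq_ker := by
      rw [Set.range_eq_empty, Ideal.span_empty]
      exact ((RingHom.injective_iff_ker_eq_bot _).mp h.1).symm
    map := PEmpty.elim
    map_inj := fun a ↦ a.elim }
  let P : Algebra.SubmersivePresentation A B (Fin d) PEmpty.{1} :=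
  { __ := P'
    jacobian_isUnit := by
      classical
      rw [Algebra.PreSubmersivePresentation.jacobian_eq_jacobiMatrix_det, Matrix.det_isEmpty,
        map_one]
      exact isUnit_one }
  exact P.isStandardSmoothOfRelativeDimension (by simp [Algebra.Presentation.dimension])

/-- If two open subschemes of `Y` cover `Y`, are geometrically irreducible over `S`, and their
intersection surjects onto `S`, then `Y` is geometrically irreducible over `S`: in every
geometric fibre they are irreducible open subsets which meet. -/
lemma geometricallyIrreducible_of_sup_eq_top {Y S : Scheme.{u}} (f : Y ⟶ S) (U V : Y.Opens)
    (hUV : U ⊔ V = ⊤) (hU : GeometricallyIrreducible (U.ι ≫ f))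
    (hV : GeometricallyIrreducible (V.ι ≫ f)) (h : Surjective ((U ⊓ V).ι ≫ f)) :
    GeometricallyIrreducible f := by
  refine ⟨fun K _ y Z fst snd hZ ↦ ?_⟩
  have hpb (U : Y.Opens) : IsPullback (fst ∣_ U) ((fst ⁻¹ᵁ U).ι ≫ snd) (U.ι ≫ f) y := by
    simpa using ((isPullback_morphismRestrict fst U).flip.paste_horiz hZ.flip).flip
  have hirr (U : Y.Opens) (hU : GeometricallyIrreducible (U.ι ≫ f)) :
      IsIrreducible ((fst ⁻¹ᵁ U : Z.Opens) : Set Z) := by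
    have : IrreducibleSpace (fst ⁻¹ᵁ U : Z.Opens).toScheme :=
      hU.geometrically_irreducibleSpace y _ _ (hpb U)
    have : IrreducibleSpace ((fst ⁻¹ᵁ U : Z.Opens) : Set Z) := this
    exact IsIrreducible.of_subtype
  have hne : ((fst ⁻¹ᵁ (U ⊓ V) : Z.Opens) : Set Z).Nonempty := by
    have : Surjective ((fst ⁻¹ᵁ (U ⊓ V)).ι ≫ snd) :=
      MorphismProperty.of_isPullback (P := @Surjective) (hpb (U ⊓ V)) h
    obtain ⟨z, -⟩ := ((fst ⁻¹ᵁ (U ⊓ V)).ι ≫ snd).surjective (Nonempty.some inferInstance)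
    exact ⟨_, z.2⟩
  obtain ⟨hU1, hU2⟩ := hirr U hU
  obtain ⟨hV1, hV2⟩ := hirr V hV
  have hcov : ((fst ⁻¹ᵁ U : Z.Opens) : Set Z) ∪ (fst ⁻¹ᵁ V : Z.Opens) = Set.univ := by
    ext z
    have : fst z ∈ U ⊔ V := hUV ▸ trivial
    simpa using this
  -- every nonempty open subset meets the intersection of the two pieces
  have key (A : Set Z) (hA : IsOpen A) (hne' : A.Nonempty) :
      ((fst ⁻¹ᵁ (U ⊓ V) : Z.Opens) ∩ A : Set Z).Nonempty := by
    obtain ⟨a, ha⟩ := hne'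
    obtain ⟨z, hz⟩ := hne
    rcases (hcov ▸ Set.mem_univ a : a ∈ _ ∪ _) with h | h
    · obtain ⟨b, hb, hb1, hb2⟩ := hU2 A _ hA (fst ⁻¹ᵁ V).isOpen ⟨a, h, ha⟩ ⟨z, hz.1, hz.2⟩
      exact ⟨b, ⟨hb, hb2⟩, hb1⟩
    · obtain ⟨b, hb, hb1, hb2⟩ := hV2 A _ hA (fst ⁻¹ᵁ U).isOpen ⟨a, h, ha⟩ ⟨z, hz.2, hz.1⟩
      exact ⟨b, ⟨hb2, hb⟩, hb1⟩
  have : PreirreducibleSpace Z := ⟨fun A B hA hB hA' hB' ↦ by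
    obtain ⟨a, ha, ha'⟩ := key A hA (by simpa using hA')
    obtain ⟨b, hb, hb'⟩ := key B hB (by simpa using hB')
    obtain ⟨c, -, hc⟩ := hU2 A B hA hB ⟨a, ha.1, ha'⟩ ⟨b, hb.1, hb'⟩
    exact ⟨c, trivial, hc⟩⟩
  exact { toNonempty := hne.to_type }

lemma geometricallyIrreducible_comp_of_isIso {Z Y S : Scheme.{u}} (e : Z ⟶ Y) [IsIso e] (f : Y ⟶ S)
    (hf : GeometricallyIrreducible f) : GeometricallyIrreducible (e ≫ f) :=
  have : MorphismProperty.RespectsIso @GeometricallyIrreducible.{u} :=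
    MorphismProperty.IsStableUnderBaseChange.respectsIso
  (MorphismProperty.cancel_left_of_respectsIso @GeometricallyIrreducible.{u} e f).mpr hf

lemma geometricallyIrreducible_SpecMap_C (W : Type u) [CommRing W] :
    GeometricallyIrreducible (Spec.map (CommRingCat.ofHom
      (MvPolynomial.C : W →+* MvPolynomial (Fin 1) W))) := by
  let e : MvPolynomial (ULift.{u} (Fin 1)) W ≃+* MvPolynomial (Fin 1) W :=
    (MvPolynomial.renameEquiv W Equiv.ulift).toRingEquiv
  have h : Spec.map (CommRingCat.ofHom (MvPolynomial.C : W →+* MvPolynomial (Fin 1) W)) =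
      Spec.map e.toCommRingCatIso.hom ≫ (AffineSpace.SpecIso _ (.of W)).inv ≫
        𝔸(ULift.{u} (Fin 1); Spec (.of W)) ↘ Spec (.of W) := by
    rw [AffineSpace.SpecIso_inv_over, ← Spec.map_comp]
    congr 1
    ext w
    simp [e]
  rw [h]
  exact geometricallyIrreducible_comp_of_isIso _ _
    (geometricallyIrreducible_comp_of_isIso _ _ inferInstance)

section Line

variable {W : Type u} [CommRing W] {Y : Scheme.{u}} (p : Y ⟶ Spec (.of W)) {V : Y.Opens}

lemma appLE_top_eq (V : Y.Opens) : p.appLE ⊤ V le_top =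
    (Scheme.ΓSpecIso (.of W)).hom ≫ CommRingCat.ofHom (structureHom p V) := by
  rw [structureHom, CommRingCat.ofHom_hom, Iso.hom_inv_id_assoc]
  rfl

lemma fromSpec_comp (hV : IsAffineOpen V) :
    hV.fromSpec ≫ p = Spec.map (CommRingCat.ofHom (structureHom p V)) := by
  rw [← IsAffineOpen.SpecMap_appLE_fromSpec p (isAffineOpen_top _) hV le_top, appLE_top_eq,
    Spec.map_comp, IsAffineOpen.fromSpec_top, Category.assoc, Scheme.isoSpec_Spec_inv,
    ← Spec.map_comp, Iso.inv_hom_id, Spec.map_id, Category.comp_id]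

variable {p} {t : Γ(Y, V)}

lemma isStandardSmoothOfRelativeDimension_appLE
    (h : Function.Bijective (MvPolynomial.eval₂Hom (structureHom p V) (fun _ : Fin 1 ↦ t))) :
    (p.appLE ⊤ V le_top).hom.IsStandardSmoothOfRelativeDimension 1 := by
  rw [appLE_top_eq]
  exact RingHom.isStandardSmoothOfRelativeDimension_respectsIso.2 _
    (Scheme.ΓSpecIso (.of W)).commRingCatIsoToRingEquiv
    (isStandardSmoothOfRelativeDimension_of_bijective _ _ h)

lemma geometricallyIrreducible_ι_comp (hV : IsAffineOpen V)
    (h : Function.Bijective (MvPolynomial.eval₂Hom (structureHom p V) (fun _ : Fin 1 ↦ t))) :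
    GeometricallyIrreducible (V.ι ≫ p) := by
  let e := RingEquiv.ofBijective _ h
  have : V.ι ≫ p = hV.isoSpec.hom ≫ Spec.map e.toCommRingCatIso.hom ≫
      Spec.map (CommRingCat.ofHom MvPolynomial.C) := by
    rw [← hV.isoSpec_hom_fromSpec, Category.assoc, fromSpec_comp p hV, ← Spec.map_comp]
    congr 2
    ext w
    simp [e]
  rw [this]
  exact geometricallyIrreducible_comp_of_isIso _ _
    (geometricallyIrreducible_comp_of_isIso _ _ (geometricallyIrreducible_SpecMap_C W))

/-- The line minus its zero section surjects onto the base: it contains the unit section. -/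
lemma surjective_basicOpen_ι_comp (hV : IsAffineOpen V)
    (h : Function.Bijective (MvPolynomial.eval₂Hom (structureHom p V) (fun _ : Fin 1 ↦ t))) :
    Surjective ((Y.basicOpen t).ι ≫ p) := by
  let e := RingEquiv.ofBijective _ h
  let τ : Γ(Y, V) →+* W :=
    (MvPolynomial.eval₂Hom (RingHom.id W) (fun _ : Fin 1 ↦ 1)).comp e.symm.toRingHom
  have hτ (w : W) : τ (structureHom p V w) = w := by
    have : e.symm (structureHom p V w) = MvPolynomial.C w := by
      rw [RingEquiv.symm_apply_eq]; simp [e]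
    simp [τ, this]
  have ht : τ t = 1 := by
    have : e.symm t = MvPolynomial.X 0 := by
      rw [RingEquiv.symm_apply_eq]; simp [e]
    simp [τ, this]
  have hσ : (Spec.map (CommRingCat.ofHom τ) ≫ hV.fromSpec) ≫ p = 𝟙 _ := by
    rw [Category.assoc, fromSpec_comp p hV, ← Spec.map_comp, ← CommRingCat.ofHom_comp,
      show τ.comp (structureHom p V) = RingHom.id W from RingHom.ext hτ, CommRingCat.ofHom_id,
      Spec.map_id]
  refine ⟨fun z ↦ ?_⟩
  have hz : (Spec.map (CommRingCat.ofHom τ) ≫ hV.fromSpec) z ∈ Y.basicOpen t := by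
    change Spec.map (CommRingCat.ofHom τ) z ∈ hV.fromSpec ⁻¹ᵁ Y.basicOpen t
    rw [hV.fromSpec_preimage_basicOpen]
    change τ t ∉ z.asIdeal
    rw [ht]
    exact fun h1 ↦ z.2.ne_top ((Ideal.eq_top_iff_one _).mpr h1)
  refine ⟨⟨_, hz⟩, ?_⟩
  exact congr($hσ z)

end Line

/-! ### Morphisms between affine schemes -/

lemma isIso_fromSpec {Y : Scheme.{u}} {V : Y.Opens} (hV : IsAffineOpen V) (hV' : V = ⊤) :
    IsIso hV.fromSpec :=
  isIso_of_isOpenImmersion_of_opensRange_eq_top _ (by rw [hV.opensRange_fromSpec, hV'])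

lemma isIso_of_bijective_structureHom {W : Type u} [CommRing W] {Y : Scheme.{u}}
    (p : Y ⟶ Spec (.of W)) {V : Y.Opens} (hV : IsAffineOpen V) (hV' : V = ⊤)
    (h : Function.Bijective (structureHom p V)) : IsIso p := by
  have := isIso_fromSpec hV hV'
  have h1 : IsIso (hV.fromSpec ≫ p) := by
    rw [fromSpec_comp]
    have : IsIso (CommRingCat.ofHom (structureHom p V)) :=
      (ConcreteCategory.isIso_iff_bijective _).mpr h
    infer_instance
  exact IsIso.of_isIso_comp_left hV.fromSpec p

lemma isClosedImmersion_of_surjective_structureHom {W : Type u} [CommRing W] {Y : Scheme.{u}}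
    (p : Y ⟶ Spec (.of W)) {V : Y.Opens} (hV : IsAffineOpen V) (hV' : V = ⊤)
    (h : Function.Surjective (structureHom p V)) : IsClosedImmersion p := by
  have := isIso_fromSpec hV hV'
  have h1 : IsClosedImmersion (hV.fromSpec ≫ p) := by
    rw [fromSpec_comp]
    exact IsClosedImmersion.spec_of_surjective _ h
  exact (MorphismProperty.cancel_left_of_respectsIso @IsClosedImmersion hV.fromSpec p).mp h1

/-- The origin is in fact a copy of `Spec W`, but a closed immersion suffices for properness. -/
lemma isClosedImmersion_origin_comp_toBase {W : Type u} [CommRing W] {n : ℕ} :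
    IsClosedImmersion ((origin W n).subschemeι ≫ toBase W n) := by
  refine isClosedImmersion_of_surjective_structureHom _
    ((isAffineOpen_top _).preimage (origin W n).subschemeι) rfl fun a ↦ ?_
  obtain ⟨b, rfl⟩ := (origin W n).subschemeι_app_surjective ⟨⊤, isAffineOpen_top _⟩ a
  obtain ⟨r, rfl⟩ := (Scheme.ΓSpecIso (.of (R W n))).commRingCatIsoToRingEquiv.symm.surjective b
  obtain ⟨w, hw⟩ := exists_sub_algebraMap_mem_originIdeal r
  refine ⟨w, ?_⟩
  have h1 : specHom (𝟙 (X W n)) ⊤ = (Scheme.ΓSpecIso (.of (R W n))).inv.hom := by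
    rw [specHom]
    simp [Scheme.Hom.appLE]
  have h2 : (Scheme.ΓSpecIso (.of (R W n))).inv.hom (r - algebraMap W (R W n) w) ∈
      RingHom.ker ((origin W n).subschemeι.app ⊤).hom := by
    rw [(origin W n).ker_subschemeι_app ⟨⊤, isAffineOpen_top _⟩, origin, closedSub,
      Scheme.IdealSheafData.ofIdealTop_ideal]
    have h3 := Ideal.mem_map_of_mem (Scheme.ΓSpecIso (.of (R W n))).inv.hom hw
    rw [originIdeal] at h3
    simpa using h3
  rw [structureHom_comp, ← Category.id_comp (toBase W n), structureHom_comp_toBase, h1]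
  rw [RingHom.mem_ker, map_sub, map_sub, sub_eq_zero] at h2
  exact h2.symm

/-- A morphism to `Spec A` is an isomorphism over the basic open subset `D(s)` as soon as the
preimage of `D(s)` is affine and its coordinate ring is the localization of `A` at `s`. -/
lemma isIso_morphismRestrict_of_isLocalization {A : Type u} [CommRing A] {Y : Scheme.{u}}
    (ρ : Y ⟶ Spec (.of A)) (s : A) (O : (Spec (.of A)).Opens)
    (hO : O = PrimeSpectrum.basicOpen s) (hV : IsAffineOpen (ρ ⁻¹ᵁ O))
    (h : letI := (specHom ρ (ρ ⁻¹ᵁ O)).toAlgebra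
      IsLocalization.Away s Γ(Y, ρ ⁻¹ᵁ O)) :
    IsIso (ρ ∣_ O) := by
  let _ := (specHom ρ (ρ ⁻¹ᵁ O)).toAlgebra
  have h2 : (hV.isoSpec.inv ≫ ρ ∣_ O) ≫ O.ι = Spec.map
      (CommRingCat.ofHom (algebraMap A Γ(Y, ρ ⁻¹ᵁ O))) := by
    rw [Category.assoc, morphismRestrict_ι, hV.isoSpec_inv_ι_assoc]
    exact fromSpec_comp ρ hV
  have h3 : IsOpenImmersion ((hV.isoSpec.inv ≫ ρ ∣_ O) ≫ O.ι) := by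
    rw [h2]
    exact IsOpenImmersion.of_isLocalization s
  have h4 : IsOpenImmersion (hV.isoSpec.inv ≫ ρ ∣_ O) := IsOpenImmersion.of_comp _ O.ι
  have h5 : IsOpenImmersion (ρ ∣_ O) :=
    (MorphismProperty.cancel_left_of_respectsIso @IsOpenImmersion hV.isoSpec.inv _).mp h4
  refine isIso_of_isOpenImmersion_of_opensRange_eq_top _ (eq_top_iff.mpr fun z _ ↦ ?_)
  have hz : z.1 ∈ Set.range (PrimeSpectrum.comap (algebraMap A Γ(Y, ρ ⁻¹ᵁ O))) := by
    rw [PrimeSpectrum.localization_away_comap_range _ s, ← hO]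
    exact z.2
  obtain ⟨w, hw⟩ := hz
  exact ⟨hV.isoSpec.inv w, Subtype.ext (congr($h2 w).trans hw)⟩

namespace AreCharts

variable {W : Type u} [CommRing W] {n : ℕ} {X' : Scheme.{u}} {ρ : X' ⟶ X W n}
  {U : Fin n → X'.affineOpens} {x : ∀ k, Fin 2 → Γ(X', (U k).1)} {E : ℕ → X'.IdealSheafData}

/-! ### The exceptional curves -/

/-- The complement of the preimage of `C` lies in the first chart. -/
lemma preimage_basicOpen_le (h : AreCharts ρ U x) (k : Fin n) (hk : k.1 = 0) :
    ρ ⁻¹ᵁ PrimeSpectrum.basicOpen (coord W n 2) ≤ (U k).1 := by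
  intro z hz
  obtain ⟨i, hi⟩ := h.exists_mem z
  obtain ⟨g, hg, -, -, hg'⟩ := h.exists_inf_eq i k
  obtain ⟨N, hN⟩ := hg' hk
  have h1 : z ∈ X'.basicOpen (specHom ρ (U i).1 (coord W n 2)) := by
    rw [basicOpen_specHom]; exact ⟨hi, hz⟩
  have h2 : z ∈ X'.basicOpen g := by
    rw [Scheme.mem_basicOpen (hx := hi)] at h1 ⊢
    refine isUnit_of_dvd_unit (map_dvd _ hN) ?_
    rw [map_pow]
    exact h1.pow N
  rw [← hg] at h2
  exact h2.2

/-- Outside `C`, which is the zero locus of `s`, the resolution is an isomorphism: both sides have the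
ring `R[1/s]`. -/
theorem isIso_morphismRestrict (h : AreCharts ρ U x) (hn : 0 < n) :
    IsIso (ρ ∣_ (C W n).support.compl) := by
  have hC : (C W n).support.compl = PrimeSpectrum.basicOpen (coord W n 2) := by
    ext z
    rw [← support_divS]
    change ¬ (z ∈ (divS W n).support) ↔ _
    rw [divS, mem_support_closedSub, Ideal.span_singleton_le_iff_mem]
    rfl
  generalize (C W n).support.compl = O at hC
  let k : Fin n := ⟨0, hn⟩
  have hle := h.preimage_basicOpen_le k rfl
  have hV : X'.basicOpen (specHom ρ (U k).1 (coord W n 2)) =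
      ρ ⁻¹ᵁ O := by
    rw [hC, basicOpen_specHom, inf_eq_right.mpr hle]
  refine isIso_morphismRestrict_of_isLocalization ρ (coord W n 2) O
    hC (hV ▸ (U k).2.basicOpen _) ?_
  rw [← hV]
  let _ := (specHom ρ (X'.basicOpen (specHom ρ (U k).1 (coord W n 2)))).toAlgebra
  have hmap (r : R W n) := specHom_map ρ (X'.basicOpen_le (specHom ρ (U k).1 (coord W n 2))) r
  have hs : IsUnit (algebraMap (R W n) Γ(X', X'.basicOpen (specHom ρ (U k).1 (coord W n 2)))
      (coord W n 2)) := by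
    change IsUnit (specHom ρ _ _)
    rw [← hmap]
    exact RingedSpace.isUnit_res_basicOpen _ _
  refine ⟨?_, ?_, ?_⟩
  · rintro ⟨_, N, rfl⟩
    rw [map_pow]
    exact hs.pow N
  · intro a
    obtain ⟨N, b, hb⟩ := exists_pow_mul_eq_map (U k).2 _ a
    obtain ⟨M, r, hr⟩ := (h.isChart k).exists_pow_mul_eq b
    refine ⟨⟨r, _, M + N, rfl⟩, ?_⟩
    change a * specHom ρ _ (coord W n 2 ^ (M + N)) = specHom ρ _ r
    rw [← hmap r, ← hr, map_mul, hb, pow_add, map_mul, map_pow, map_pow, map_pow, hmap]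
    ring
  · intro r t hrt
    change specHom ρ _ r = specHom ρ _ t at hrt
    have := (U k).2.isLocalization_basicOpen (specHom ρ (U k).1 (coord W n 2))
    rw [← hmap, ← hmap] at hrt
    obtain ⟨⟨_, N, rfl⟩, hN⟩ := IsLocalization.exists_of_eq
      (M := Submonoid.powers (specHom ρ (U k).1 (coord W n 2))) hrt
    refine ⟨⟨_, N, rfl⟩, h.injective k ?_⟩
    simpa only [map_mul, map_pow] using hN

section Subscheme

variable {i : ℕ}

/-- On the pieces cut out by the charts, an exceptional curve is an affine line over `W`, with the
other coordinate of the chart as its coordinate. -/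
lemma bijective_structureHom_subscheme (h : AreCharts ρ U x) {I : X'.IdealSheafData} (k : Fin n)
    (j : Fin 2) (hI : I.ideal (U k) = Ideal.span {x k j}) (h0 : 0 < k.1 + j.1)
    (h1 : k.1 + j.1 < n) :
    Function.Bijective (MvPolynomial.eval₂Hom
      (structureHom (I.subschemeι ≫ ρ ≫ toBase W n) (I.subschemeι ⁻¹ᵁ (U k).1))
      (fun _ : Fin 1 ↦ I.subschemeι.app (U k).1 (x k (1 - j)))) := by
  have hj : (originIdeal W n).map (specHom ρ (U k).1) ≤ Ideal.span {x k j} := by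
    fin_cases j
    · exact (h.isChart k).map_originIdeal_le_span_zero (by simpa using h0)
    · exact (h.isChart k).map_originIdeal_le_span_one (by simpa using h1)
  have h2 := (h.isChart k).bijective_mvPolynomial_one j hj (I.subschemeι.app (U k).1).hom
    (I.subschemeι_app_surjective (U k)) (by rw [I.ker_subschemeι_app, hI])
  rw [structureHom_comp, structureHom_comp_toBase]
  have h3 (l : Fin 1) : j.succAbove l = 1 - j := by
    fin_cases j <;> fin_cases l <;> rfl
  simpa only [h3] using h2

theorem isExceptionalCurve (h : AreCharts ρ U x) (h0 : 0 < i) (hi : i < n)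
    (hE : ∀ k, (E i).ideal (U k) = Ideal.span {componentEq x k i}) :
    IsExceptionalCurve ρ (E i) := by
  have := h.isProper
  have hle := h.comap_origin_le h0 hi hE
  refine ⟨hle, ?_, ⟨fun z ↦ ?_⟩, ?_⟩
  · -- `E i` is closed in `X'` and `ρ` maps it to the origin, a copy of `Spec W`
    have hle' : origin W n ≤ (E i).map ρ := Scheme.IdealSheafData.le_map_iff_comap_le.mpr hle
    have h1 := Scheme.IdealSheafData.subschemeMap_subschemeι (E i) (origin W n) ρ hle'
    have h2 : IsProper ((E i).subschemeMap (origin W n) ρ hle') := by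
      have : IsProper ((E i).subschemeMap (origin W n) ρ hle' ≫ (origin W n).subschemeι) := by
        rw [h1]; infer_instance
      exact IsProper.of_comp _ (origin W n).subschemeι
    have h3 := isClosedImmersion_origin_comp_toBase (W := W) (n := n)
    rw [← Category.assoc, ← h1, Category.assoc]
    infer_instance
  · obtain ⟨k, j, hk, hkj, hj⟩ := h.exists_mem_of_subscheme hE z
    exact ⟨⊤, isAffineOpen_top _, (E i).subschemeι ⁻¹ᵁ (U k).1, (U k).2.preimage _, hk, le_top,
      isStandardSmoothOfRelativeDimension_appLE
        (h.bijective_structureHom_subscheme k j hj (by omega) (by omega))⟩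
  · -- `E i` is covered by the charts `i - 1` and `i`
    let k : Fin n := ⟨i - 1, by omega⟩
    let l : Fin n := ⟨i, hi⟩
    have hk : (E i).ideal (U k) = Ideal.span {x k 1} := by
      rw [hE, componentEq, if_neg (show i - 1 ≠ i by omega),
        if_pos (show i - 1 + 1 = i by omega)]
    have hl : (E i).ideal (U l) = Ideal.span {x l 0} := by
      rw [hE, componentEq, if_pos rfl]
    have hk' := h.bijective_structureHom_subscheme k 1 hk
      (by simp) (by change i - 1 + 1 < n; omega)
    have hl' := h.bijective_structureHom_subscheme l 0 hl (by simpa [l] using h0)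
      (by simpa [l] using hi)
    refine geometricallyIrreducible_of_sup_eq_top _ ((E i).subschemeι ⁻¹ᵁ (U k).1)
      ((E i).subschemeι ⁻¹ᵁ (U l).1) ?_
      (geometricallyIrreducible_ι_comp ((U k).2.preimage _) hk')
      (geometricallyIrreducible_ι_comp ((U l).2.preimage _) hl') ?_
    · refine eq_top_iff.mpr fun z _ ↦ ?_
      obtain ⟨m, j, hm, hmj, -⟩ := h.exists_mem_of_subscheme hE z
      fin_cases j
      · exact .inr (by rwa [show m = l from Fin.ext hmj] at hm)
      · exact .inl (by rwa [show m = k from Fin.ext (by simp at hmj; simp [k]; omega)] at hm)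
    · have := surjective_basicOpen_ι_comp ((U k).2.preimage _) hk'
      have h4 : (E i).subschemeι ⁻¹ᵁ (U k).1 ⊓ (E i).subschemeι ⁻¹ᵁ (U l).1 =
          (E i).subscheme.basicOpen ((E i).subschemeι.app (U k).1 (x k (1 - 1))) := by
        rw [← Scheme.preimage_basicOpen, sub_self,
          ← h.inf_succ k l (by simp [k, l]; omega)]
        rfl
      rwa [h4]

/-- Neighbouring components meet in the origin `u = v = 0` of one chart. -/
theorem isIso_sup (h : AreCharts ρ U x) (hE : ∀ i ∈ Finset.Icc 1 n, ∀ k, (E i).ideal (U k) =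
    Ideal.span {componentEq x k i}) (h0 : 0 < i) (hi : i < n) :
    IsIso ((E i ⊔ E (i + 1)).subschemeι ≫ ρ ≫ toBase W n) := by
  let l : Fin n := ⟨i, hi⟩
  have hl (k) : (E i ⊔ E (i + 1)).ideal (U k) =
      Ideal.span {componentEq x k i} ⊔ Ideal.span {componentEq x k (i + 1)} := by
    rw [← hE i (by simp; omega), ← hE (i + 1) (by simp; omega)]
    rfl
  generalize E i ⊔ E (i + 1) = I at hl
  have hI : I.ideal (U l) = Ideal.span (Set.range (x l)) := by
    rw [hl, componentEq, componentEq, if_pos rfl, if_neg (by simp [l]), if_pos rfl,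
      ← Ideal.span_union]
    congr 1
    ext a
    simp [Fin.exists_fin_two, eq_comm, or_comm]
  have hI' (k) (hk : k ≠ l) : I.ideal (U k) = ⊤ := by
    have hk' : k.1 ≠ i := fun h ↦ hk (Fin.ext h)
    rw [hl, componentEq, componentEq, if_neg hk', if_neg (show ¬ k.1 + 1 = i + 1 by omega)]
    by_cases h1 : k.1 = i + 1
    · rw [if_neg (by omega), Ideal.span_singleton_one, top_sup_eq]
    · rw [if_neg h1, Ideal.span_singleton_one, sup_top_eq]
  refine isIso_of_bijective_structureHom _ ((U l).2.preimage I.subschemeι)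
    (eq_top_iff.mpr fun z _ ↦ ?_) ?_
  · obtain ⟨k, hk⟩ := h.exists_mem (I.subschemeι z)
    by_cases hkl : k = l
    · exact hkl ▸ hk
    · exact (notMem_of_ideal_eq_top (hI' k hkl) z hk).elim
  · rw [structureHom_comp, structureHom_comp_toBase]
    exact (h.isChart l).bijective_quotient_span_range (I.subschemeι.app (U l).1).hom
      (I.subschemeι_app_surjective (U l)) (by rw [I.ker_subschemeι_app, hI])

end Subscheme

end AreCharts

end AnSing

end

theorem mainTheorem10 (W : Type u) [CommRing W] (n : ℕ) (hn : 0 < n) (hW : IsUnit (n : W)) :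
    ∃ (X' : Scheme.{u}) (ρ : X' ⟶ AnSing.X W n) (E : ℕ → X'.IdealSheafData),
      -- `ρ` is proper and `X'` is a smooth surface over `W`
      IsProper ρ ∧
      AnSing.IsSmoothOver (ρ ≫ AnSing.toBase W n) ((AnSing.origin W n).comap ρ) 2 ∧
      -- `ρ` is an isomorphism over `X \ C`
      IsIso (ρ ∣_ (AnSing.C W n).support.compl) ∧
      -- `E 1, …, E (n - 1)` are exceptional curves, `E n` is the proper transform of `C`
      (∀ i ∈ Finset.Ico 1 n, AnSing.IsExceptionalCurve ρ (E i)) ∧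
      E n = AnSing.properTransform ρ ∧
      -- the preimage of `C` is the support of the divisor `∑ i, i E i`, the pull-back of `{s = 0}`
      ((∏ i ∈ Finset.Icc 1 n, E i ^ i).support : Set X') = ρ ⁻¹' (AnSing.C W n).support ∧
      (AnSing.divS W n).comap ρ = ∏ i ∈ Finset.Icc 1 n, E i ^ i ∧
      -- `E 1 + ⋯ + E n` is a simple relative normal crossing divisor over `W`
      AnSing.IsSimpleRelativeNCD (ρ ≫ AnSing.toBase W n) ((AnSing.origin W n).comap ρ) 2
        (Finset.Icc 1 n) E ∧
      -- `E 1, …, E n` is a chain: neighbours meet in one section over `W`, others are disjoint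
      (∀ i ∈ Finset.Ico 1 n, IsIso ((E i ⊔ E (i + 1)).subschemeι ≫ ρ ≫ AnSing.toBase W n)) ∧
      (∀ i ∈ Finset.Icc 1 n, ∀ j ∈ Finset.Icc 1 n, i + 1 < j → E i ⊔ E j = ⊤) := by
  obtain ⟨X', ρ, U, x, h⟩ := AnSing.exists_areCharts W hn
  have hex (i : ℕ) (hi : i < n) := h.exists_ideal_eq_span ⟨i, hi⟩
  choose F hF using hex
  let E (i : ℕ) : X'.IdealSheafData := if hi : i < n then F i hi else AnSing.properTransform ρ
  have hE (i : ℕ) (hi : i ∈ Finset.Icc 1 n) (k : Fin n) :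
      (E i).ideal (U k) = Ideal.span {AnSing.AreCharts.componentEq x k i} := by
    obtain hin | rfl := (Finset.mem_Icc.mp hi).2.lt_or_eq
    · simp only [E, dif_pos hin]
      exact hF i hin k
    · simp only [E, lt_irrefl, dite_false]
      exact h.ideal_properTransform k
  refine ⟨X', ρ, E, h.isProper, h.isSmoothOver, h.isIso_morphismRestrict hn, fun i hi ↦ ?_,
    dif_neg (lt_irrefl n), ?_, h.comap_divS hE, ⟨h.isRelativeNCD hE, fun i hi ↦ ?_⟩,
    fun i hi ↦ ?_, fun i hi j hj hij ↦ h.sup_eq_top hE hi hj hij⟩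
  · rw [Finset.mem_Ico] at hi
    exact h.isExceptionalCurve hi.1 hi.2 (hE i (by simp; omega))
  · rw [← h.comap_divS hE, Scheme.IdealSheafData.support_comap, AnSing.support_divS]
    rfl
  · exact h.isSmoothOver_subscheme (hE i hi)
  · rw [Finset.mem_Ico] at hi
    exact h.isIso_sup hE hi.1 hi.2
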